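/- Let $k\ge 3$ be an integer and let $\chi$, $\psi$ be primitive Dirichlet characters modulo $L$ and $M$ respectively, with $\chi(-1)\psi(-1)=(-1)^k$ and $\psi\ne 1$. For $\tau$ in the upper half-plane $\mathcal H$ let $$E_k(\tau;\chi,\psi)=\sum_{(m,n)\in\mathbb Z^2\setminus\{(0,0)\}}\frac{\chi(m)\psi(n)}{(m\tau+n)^k},\qquad \tilde E_k(\tau;\chi,\psi)=\int_\tau^{i\infty}\bigl[E_k(z;\chi,\psi)-E_k(i\infty;\chi,\psi)\bigr](z-\tau)^{k-2}\,dz,$$ where $E_k(i\infty;\chi,\psi)=\lim_{\operatorname{Im} z\to\infty}E_k(z;\chi,\psi)$ (the series and the integral converge absolutely, and the limit exists). Let $R=\begin{pmatrix}1&0\\1&1\end{pmatrix}$, write $(f|_{2-k}\gamma)(\tau)=(c\tau+d)^{k-2}f\bigl(\tfrac{a\tau+b}{c\tau+d}\bigr)$ for $\gamma=\begin{pmatrix}a&b\\c&d\end{pmatrix}\in SL_2(\mathbb Z)$ and $f|_{2-k}(1-\gamma)=f-f|_{2-k}\gamma$, and let $L(s,\chi)$, $L(s,\psi)$ be the (analytically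 continued) Dirichlet $L$-functions. Then for every integer $n$ with $L\mid n$ and every $X\in\mathcal H$, $$\tilde E_k(X;\chi,\psi)\big|_{2-k}(1-R^n)=-\frac{4\psi(-1)}{k-1}\sum_{\substack{0\le s\le k\\ \chi(-1)=(-1)^s}}L(s,\chi)\,L(k-s,\psi)\,X^{k-s-1}\bigl(1-(nX+1)^{s-1}\bigr).$$ In the case $\chi=1$ (modulo $1$), $\psi=\chi_{-4}$ (the nonprincipal character modulo $4$), $k=2m+1$ with $m\ge1$: the secant Dirichlet series $\psi_{2m}(\tau)=\sum_{n\ge1}\sec(\pi n\tau)/n^{2m}$, which converges absolutely for all nonreal $\tau$, satisfies $\psi_{2m}(\tau/2)=\frac{2m}{\pi}\tilde E_{2m+1}(\tau;1,\chi_{-4})$ for $\tau\in\mathcal H$, and for all nonreal $\tau\in\mathbb C$ $$(2\tau+1)^{2m-1}\psi_{2m}\Bigl(\frac{\tau}{2\tau+1}\Bigr)-\psi_{2m}(\tau)=(\pi i)^{2m}\sum_{n=0}^m\frac{2^{2n-1}B_{2n}E_{2m-2n}}{(2n)!\,(2m-2n)!}\,\tau^{2m-2n}\bigl[1-(2\tau+1)^{2n-1}\bigr],$$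 where $B_j$ are the Bernoulli numbers and $E_j$ the Euler numbers, defined by $\operatorname{sech}x=\sum_{j\ge0}E_jx^j/j!$. -/

import Mathlib

open UpperHalfPlane hiding I
open Complex
open scoped MatrixGroups ModularForm

noncomputable section

/-- The `(m, n)`-term `χ(m) ψ(n) / (m τ + n) ^ k` of the Eisenstein series, the pair `(0, 0)` being
left out of the summation. -/
def eisensteinTerm (k : ℕ) {L M : ℕ} (χ : DirichletCharacter ℂ L) (ψ : DirichletCharacter ℂ M)
    (τ : ℍ) (p : ℤ × ℤ) : ℂ :=
  if p = 0 then 0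
  else χ (p.1 : ZMod L) * ψ (p.2 : ZMod M) / ((p.1 : ℂ) * (τ : ℂ) + (p.2 : ℂ)) ^ k

/-- The Eisenstein series `E_k(τ; χ, ψ) = ∑' χ(m) ψ(n) / (m τ + n) ^ k`, summed over all pairs of
integers `(m, n) ≠ (0, 0)`. -/
def eisensteinChar (k : ℕ) {L M : ℕ} (χ : DirichletCharacter ℂ L) (ψ : DirichletCharacter ℂ M)
    (τ : ℍ) : ℂ :=
  ∑' p : ℤ × ℤ, eisensteinTerm k χ ψ τ p

/-- The integrand of the Eichler integral of `f` (of weight `k`) along the vertical half-line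
`z = τ + i t`, `t > 0`:
`[f(z) - a₀(f)] (z - τ) ^ (k - 2) dz` with `z - τ = i t`, `dz = i dt` and `a₀(f) = f(i∞)`. -/
def eichlerIntegrand (k : ℕ) (f : ℍ → ℂ) (τ : ℍ) (t : ℝ) : ℂ :=
  (f (ofComplex ((τ : ℂ) + (t : ℂ) * I)) - valueAtInfty f) * ((t : ℂ) * I) ^ ((k : ℤ) - 2) * I

/-- The Eichler integral `∫_τ^{i∞} [f(z) - a₀(f)] (z - τ) ^ (k - 2) dz`, with `a₀(f) = f(i∞)`. -/
def eichlerIntegral (k : ℕ) (f : ℍ → ℂ) (τ : ℍ) : ℂ :=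
  ∫ t in Set.Ioi (0 : ℝ), eichlerIntegrand k f τ t

/-- The Eichler integral `Ẽ_k(τ; χ, ψ)` of the Eisenstein series `E_k(τ; χ, ψ)`. -/
def eichlerEisenstein (k : ℕ) {L M : ℕ} (χ : DirichletCharacter ℂ L)
    (ψ : DirichletCharacter ℂ M) : ℍ → ℂ :=
  eichlerIntegral k (eisensteinChar k χ ψ)

/-- The matrix `R = (1 0; 1 1)`. -/
def matR : SL(2, ℤ) := ⟨!![1, 0; 1, 1], by simp [Matrix.det_fin_two]⟩

/-- The nonprincipal Dirichlet character modulo `4`, with complex values. -/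
def chiNegFour : DirichletCharacter ℂ 4 := ZMod.χ₄.ringHomComp (Int.castRingHom ℂ)

/-- The term with index `n + 1` of the secant Dirichlet series, `sec(π (n + 1) τ) / (n + 1) ^ s`. -/
def secantTerm (s : ℕ) (τ : ℂ) (n : ℕ) : ℂ :=
  (Complex.cos (Real.pi * ((n : ℂ) + 1) * τ))⁻¹ / ((n : ℂ) + 1) ^ s

/-- The secant Dirichlet series `ψ_s(τ) = ∑_{n ≥ 1} sec(π n τ) / n ^ s`. -/
def secantSeries (s : ℕ) (τ : ℂ) : ℂ := ∑' n : ℕ, secantTerm s τ n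

/-- The Euler numbers, `sech x = ∑ E_n x ^ n / n!`, where `sech` is the inverse of the power series
`cosh x = ∑_{n even} x ^ n / n!`. -/
def eulerNum (n : ℕ) : ℚ :=
  (n.factorial : ℚ) *
    PowerSeries.coeff n (PowerSeries.mk fun j : ℕ => if Even j then (j.factorial : ℚ)⁻¹ else 0)⁻¹

end

/-!
Integrating termwise, `∫ (z - τ) ^ (k - 2) (m z + n) ^ (-k) dz` from `τ` to `i∞` is
`1 / ((k - 1) m ^ (k - 1) (m τ + n))`, so up to the factor `k - 1` the Eichler integral should be
the double series `F(τ; χ, ψ) = ∑ χ(a) a ^ (1 - k) ∑ ψ(b) / (a τ + b)`, whose inner series converges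
conditionally to a finite sum of cotangents (`charCot`, `cotSeries`). This is proved on the level of
Fourier expansions, where everything converges absolutely: the Lipschitz formula for `E_k` and
the geometric expansion of the cotangent match term by term (`eichlerEisenstein_eq_cotSeries`).

The functional equation comes from expanding `1 / (a ^ (k - 1) (a τ + b))` geometrically in
`a τ / b`. The first `k - 1` terms sum to products of `L`-values, and the remainder is
`(-τ) ^ (k - 1) / (b ^ (k - 1) (a τ + b))`. Hence `F(τ; χ, ψ)` equals an explicit Laurent
polynomial plus `(-τ) ^ (k - 1) / τ * F(1 / τ; ψ, χ)` (`cotSeries_reciprocity`). The matrix `R ^ n`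
translates `1 / τ` by `n`, and `F(·; ψ, χ)` has period `L` because the cotangent is periodic; so
only the Laurent polynomial contributes to `F - F | R ^ n` (`cotSeries_sub_slash`). Conditional
convergence is handled by taking symmetric partial sums over `|a|, |b| ≤ N`, with a bound
on the inner sums that grows like the square root of `|a|` (`exists_norm_sum_Icc_le`); the value
at `s = 1` is reached by Abel summation (`tendsto_sum_char_div`).

For `χ = 1` and `ψ = χ₋₄` the cotangent sum is `(π / 2) sec (π w / 2)`, which gives the secant
Dirichlet series. Its coefficients are evaluated with Euler's formula for `ζ(2n)` and with
`L(2j + 1, χ₋₄)`, which is a Bernoulli polynomial at `1 / 4` and hence an Euler number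
(`bernoulli_eval_one_quarter`, `LFunction_chiNegFour`). Complex conjugation transfers the
result to the lower half-plane.
-/

noncomputable section

open Filter Topology MeasureTheory

/-! ### Partial sums of Dirichlet `L`-series -/

lemma sum_range_zmod {N : ℕ} [NeZero N] {E : Type*} [AddCommMonoid E] (f : ZMod N → E) :
    ∑ j ∈ Finset.range N, f (j : ZMod N) = ∑ j : ZMod N, f j := by
  refine Finset.sum_nbij' (fun j : ℕ ↦ (j : ZMod N)) ZMod.val ?_ ?_ ?_ ?_ ?_
  · simp
  · intro a _
    simpa using ZMod.val_lt a
  · intro a ha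
    exact ZMod.val_cast_of_lt (Finset.mem_range.mp ha)
  · intro a _
    simp
  · simp

/-- Partial sums of a nontrivial character are bounded, since its sum over a period vanishes. -/
lemma norm_sum_range_char_le {N : ℕ} [NeZero N] {χ : DirichletCharacter ℂ N} (hχ : χ ≠ 1) (n : ℕ) :
    ‖∑ i ∈ Finset.range n, χ ((i + 1 : ℕ) : ZMod N)‖ ≤ N := by
  induction n using Nat.strong_induction_on with
  | _ n ih =>
    rcases lt_or_ge n N with h | h
    · calc _ ≤ ∑ i ∈ Finset.range n, ‖χ ((i + 1 : ℕ) : ZMod N)‖ := norm_sum_le _ _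
        _ ≤ ∑ i ∈ Finset.range n, (1 : ℝ) := Finset.sum_le_sum fun i _ ↦ χ.norm_le_one _
        _ ≤ N := by simpa using h.le
    · obtain ⟨m, rfl⟩ := Nat.exists_eq_add_of_le' h
      rw [Finset.sum_range_add]
      have h0 : ∑ x ∈ Finset.range N, χ ((m + x + 1 : ℕ) : ZMod N) = 0 := by
        have h1 := sum_range_zmod (fun j : ZMod N ↦ χ ((m : ZMod N) + j + 1))
        have h2 := Equiv.sum_comp (Equiv.addRight ((m : ZMod N) + 1)) (fun j ↦ χ j)
        rw [MulChar.sum_eq_zero_of_ne_one hχ] at h2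
        rw [← h2]
        push_cast
        rw [h1]
        refine Finset.sum_congr rfl fun j _ ↦ ?_
        congr 1
        simp only [Equiv.coe_addRight]
        ring
      rw [h0, add_zero]
      exact ih m (by have := NeZero.pos N; omega)

lemma rpow_neg_sub_rpow_neg_le (i : ℕ) {s : ℝ} (h1 : 1 ≤ s) (h2 : s ≤ 2) :
    |((i : ℝ) + 1 + 1) ^ (-s) - ((i : ℝ) + 1) ^ (-s)| ≤ 2 * (1 / ((i : ℝ) + 1) ^ 2) := by
  have hp : (0 : ℝ) < (i : ℝ) + 1 := by positivity
  set y : ℝ := (i : ℝ) + 1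
  have hy1 : 1 ≤ y := by simp [y]
  set x : ℝ := y / (y + 1)
  have hx0 : 0 < x := by positivity
  have hx1 : x ≤ 1 := by rw [div_le_one (by positivity)]; linarith
  have e1 : (y + 1) ^ (-s) = y ^ (-s) * x ^ s := by
    rw [Real.div_rpow (by positivity) (by positivity), Real.rpow_neg (by positivity),
      Real.rpow_neg (by positivity)]
    field_simp
  have hxs : x ^ (2 : ℝ) ≤ x ^ s := Real.rpow_le_rpow_of_exponent_ge hx0 hx1 h2
  have hxs1 : x ^ s ≤ 1 := Real.rpow_le_one hx0.le hx1 (by linarith)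
  have hys : y ^ (-s) ≤ y⁻¹ := by
    rw [← Real.rpow_neg_one]
    exact Real.rpow_le_rpow_of_exponent_le hy1 (by linarith)
  have hys0 : 0 ≤ y ^ (-s) := by positivity
  rw [Real.rpow_two] at hxs
  rw [e1, abs_sub_comm, abs_of_nonneg (by nlinarith)]
  have h3 : 1 - x ≤ 1 / y := by
    rw [show 1 - x = 1 / (y + 1) by simp only [x]; field_simp; ring]
    gcongr
    linarith
  calc y ^ (-s) - y ^ (-s) * x ^ s = y ^ (-s) * (1 - x ^ s) := by ring
    _ ≤ y⁻¹ * (2 * (1 - x)) := by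
        gcongr
        nlinarith [sq_nonneg (1 - x)]
    _ ≤ y⁻¹ * (2 * (1 / y)) := by gcongr
    _ = _ := by field_simp

/-- The `L`-series of a nontrivial character converges (conditionally) at `s = 1` to the value of
the entire function `L(s, χ)`: summation by parts makes it a series converging uniformly on
`1 ≤ s ≤ 2`. -/
lemma tendsto_sum_char_div {N : ℕ} [NeZero N] {χ : DirichletCharacter ℂ N} (hχ : χ ≠ 1) :
    Tendsto (fun n : ℕ ↦ ∑ a ∈ Finset.range (n + 1), χ (a : ZMod N) / (a : ℂ)) atTop
      (𝓝 (χ.LFunction 1)) := by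
  set G : ℕ → ℂ := fun n ↦ ∑ i ∈ Finset.range n, χ ((i + 1 : ℕ) : ZMod N) with hG
  have hGb : ∀ n, ‖G n‖ ≤ N := norm_sum_range_char_le hχ
  set h : ℝ → ℕ → ℂ := fun s i ↦
    (((i : ℝ) + 1 + 1) ^ (-s) - ((i : ℝ) + 1) ^ (-s)) • G (i + 1) with hh
  set bound : ℕ → ℝ := fun i ↦ 2 * (1 / ((i : ℝ) + 1) ^ 2) * N with hb
  have hbs : Summable bound := by
    refine Summable.mul_right _ (Summable.mul_left _ ?_)
    simpa using (summable_nat_add_iff 1).mpr (Real.summable_one_div_nat_pow.mpr one_lt_two)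
  have hle : ∀ s, 1 ≤ s → s ≤ 2 → ∀ i, ‖h s i‖ ≤ bound i := by
    intro s h1 h2 i
    simp only [hh, hb, norm_smul, Real.norm_eq_abs]
    gcongr
    · exact rpow_neg_sub_rpow_neg_le i h1 h2
    · exact hGb _
  have hsm : ∀ s, 1 ≤ s → s ≤ 2 → Summable (h s) := fun s h1 h2 ↦
    Summable.of_norm_bounded hbs (hle s h1 h2)
  -- Summation by parts turns the `L`-series into the absolutely convergent series `-∑ h s i`.
  have hpart : ∀ s : ℝ, 1 ≤ s → s ≤ 2 → Tendsto (fun n : ℕ ↦ ∑ i ∈ Finset.range n,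
      (((i : ℝ) + 1) ^ (-s)) • χ ((i + 1 : ℕ) : ZMod N)) atTop (𝓝 (-∑' i, h s i)) := by
    intro s h1 h2
    rw [← tendsto_add_atTop_iff_nat 1]
    have e : ∀ n : ℕ, ∑ i ∈ Finset.range (n + 1),
        (((i : ℝ) + 1) ^ (-s)) • χ ((i + 1 : ℕ) : ZMod N) =
        (((n : ℝ) + 1) ^ (-s)) • G (n + 1) - ∑ i ∈ Finset.range n, h s i := by
      intro n
      rw [Finset.sum_range_by_parts (fun i : ℕ ↦ ((i : ℝ) + 1) ^ (-s))]
      simp [hh, hG]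
    simp_rw [e]
    have t1 : Tendsto (fun n : ℕ ↦ (((n : ℝ) + 1) ^ (-s)) • G (n + 1)) atTop (𝓝 0) := by
      refine Tendsto.zero_smul_isBoundedUnder_le ?_
        (isBoundedUnder_of ⟨(N : ℝ), fun n ↦ hGb (n + 1)⟩)
      have := tendsto_rpow_neg_atTop (show 0 < s by linarith)
      exact this.comp (tendsto_atTop_add_const_right _ _ tendsto_natCast_atTop_atTop)
    simpa using t1.sub (hsm s h1 h2).hasSum.tendsto_sum_nat
  have hcpow : ∀ (s : ℝ) (i : ℕ), (((i : ℝ) + 1) ^ (-s)) • χ ((i + 1 : ℕ) : ZMod N) =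
      LSeries.term (fun n ↦ χ (n : ZMod N)) s (i + 1) := by
    intro s i
    rw [LSeries.term_of_ne_zero (by omega), Complex.real_smul, Complex.ofReal_cpow (by positivity),
      Complex.ofReal_neg, Complex.cpow_neg, div_eq_mul_inv, mul_comm]
    push_cast
    rfl
  have hval : ∀ s : ℝ, 1 < s → s ≤ 2 → χ.LFunction s = -∑' i, h s i := by
    intro s h1 h2
    refine tendsto_nhds_unique ?_ (hpart s h1.le h2)
    rw [DirichletCharacter.LFunction_eq_LSeries χ (by simpa using h1)]
    have hs := DirichletCharacter.LSeriesSummable_of_one_lt_re χ (s := s) (by simpa using h1)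
    have h3 := (hasSum_nat_add_iff' 1).mpr hs.hasSum
    simp only [Finset.range_one, Finset.sum_singleton, LSeries.term_zero, sub_zero] at h3
    simp_rw [hcpow]
    exact h3.tendsto_sum_nat
  -- Let `s → 1+` on both sides of the identity `hval`; the limits agree with the value at `1`.
  have hlim1 : Tendsto (fun s : ℝ ↦ -∑' i, h s i) (𝓝[>] 1) (𝓝 (-∑' i, h 1 i)) := by
    refine (tendsto_tsum_of_dominated_convergence hbs (fun i ↦ ?_) ?_).neg
    · refine Tendsto.mono_left ?_ nhdsWithin_le_nhds
      have : Continuous fun s : ℝ ↦ h s i := by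
        simp only [hh]
        refine Continuous.fun_smul (Continuous.fun_sub ?_ ?_) continuous_const
        · exact Continuous.rpow continuous_const continuous_neg fun x ↦ Or.inl (by positivity)
        · exact Continuous.rpow continuous_const continuous_neg fun x ↦ Or.inl (by positivity)
      exact this.tendsto 1
    · filter_upwards [Ioc_mem_nhdsGT one_lt_two] with s hs i
      exact hle s hs.1.le hs.2 i
  have hlim2 : Tendsto (fun s : ℝ ↦ -∑' i, h s i) (𝓝[>] 1) (𝓝 (χ.LFunction 1)) := by
    have hc : Tendsto (fun s : ℝ ↦ χ.LFunction s) (𝓝[>] 1) (𝓝 (χ.LFunction ((1 : ℝ) : ℂ))) :=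
      (((DirichletCharacter.differentiable_LFunction hχ).continuous.comp
        continuous_ofReal).tendsto 1).mono_left nhdsWithin_le_nhds
    rw [ofReal_one] at hc
    refine hc.congr' ?_
    filter_upwards [Ioc_mem_nhdsGT one_lt_two] with s hs
    exact hval s hs.1 hs.2
  rw [tendsto_nhds_unique hlim2 hlim1]
  refine (hpart 1 le_rfl one_le_two).congr fun n ↦ ?_
  rw [Finset.sum_range_succ']
  simp only [Nat.cast_zero, div_zero, add_zero]
  refine Finset.sum_congr rfl fun i _ ↦ ?_
  rw [Complex.real_smul, Real.rpow_neg_one, div_eq_mul_inv, mul_comm]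
  push_cast
  rfl

lemma sum_Icc_neg_eq {E : Type*} [AddCommMonoid E] (f : ℤ → E) (n : ℕ) :
    ∑ a ∈ Finset.Icc (-n : ℤ) n, f a =
      f 0 + ∑ a ∈ Finset.range n, (f ((a : ℤ) + 1) + f (-((a : ℤ) + 1))) := by
  induction n with
  | zero => simp
  | succ n ih =>
    have : Finset.Icc (-(n + 1 : ℕ) : ℤ) (n + 1 : ℕ) =
        insert ((n : ℤ) + 1) (insert (-((n : ℤ) + 1)) (Finset.Icc (-n : ℤ) n)) := by
      ext x
      simp only [Finset.mem_Icc, Finset.mem_insert]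
      push_cast
      omega
    rw [this, Finset.sum_insert (by simp; omega), Finset.sum_insert (by simp), ih,
      Finset.sum_range_succ]
    abel

/-- Symmetric partial sums of `∑ χ(a) / a ^ s` over the integers; the term `a = 0` is `0` by the
convention on division. For `s = 1` and `χ` trivial the partial sums vanish. -/
lemma tendsto_sum_Icc_char_div_pow {N : ℕ} [NeZero N] (χ : DirichletCharacter ℂ N) {s : ℕ}
    (hs : 1 ≤ s) :
    Tendsto (fun n : ℕ ↦ ∑ a ∈ Finset.Icc (-n : ℤ) n, χ (a : ZMod N) / (a : ℂ) ^ s) atTop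
      (𝓝 ((1 + χ (-1) * (-1) ^ s) * χ.LFunction s)) := by
  have e : ∀ n : ℕ, ∑ a ∈ Finset.Icc (-n : ℤ) n, χ (a : ZMod N) / (a : ℂ) ^ s =
      (1 + χ (-1) * (-1) ^ s) * ∑ a ∈ Finset.range (n + 1), χ (a : ZMod N) / (a : ℂ) ^ s := by
    intro n
    rw [sum_Icc_neg_eq, Finset.sum_range_succ', mul_add, Finset.mul_sum, add_comm]
    congr 1
    · refine Finset.sum_congr rfl fun a _ ↦ ?_
      push_cast
      rw [neg_eq_neg_one_mul ((a : ZMod N) + 1), map_mul, neg_pow ((a : ℂ) + 1), add_mul, one_mul]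
      congr 1
      rcases neg_one_pow_eq_or ℂ s with h | h <;> rw [h] <;> field_simp
    · simp [show s ≠ 0 by omega]
  simp_rw [e]
  rcases eq_or_lt_of_le hs with rfl | hs
  · by_cases hχ : χ = 1
    · subst hχ
      have : (1 : DirichletCharacter ℂ N) (-1) = 1 :=
        MulChar.one_apply (isUnit_one.neg)
      simp [this]
    · simpa using (tendsto_sum_char_div hχ).const_mul (1 + χ (-1) * (-1))
  · refine Tendsto.const_mul _ ?_
    have h1 : 1 < ((s : ℂ)).re := by simpa using hs
    rw [DirichletCharacter.LFunction_eq_LSeries χ h1]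
    have h2 := (DirichletCharacter.LSeriesSummable_of_one_lt_re χ h1).hasSum
    refine ((tendsto_add_atTop_iff_nat 1).mpr h2.tendsto_sum_nat).congr fun n ↦ ?_
    refine Finset.sum_congr rfl fun a _ ↦ ?_
    rcases eq_or_ne a 0 with rfl | ha
    · simp [show s ≠ 0 by omega]
    · rw [LSeries.term_of_ne_zero ha, Complex.cpow_natCast]

/-! ### Cotangent sums attached to a character -/

/-- The cotangent sum `N⁻¹ ∑ j, χ(j) π cot(π (w + j) / N)`; for nonreal `w` this is the
symmetrically summed series `∑ χ(a) / (w + a)` over all integers `a`. -/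
def charCot {N : ℕ} (χ : DirichletCharacter ℂ N) (w : ℂ) : ℂ :=
  (N : ℂ)⁻¹ * ∑ j ∈ Finset.range N,
    χ (j : ZMod N) * (Real.pi * Complex.cot (Real.pi * ((w + j) / N)))

lemma mem_integerComplement_of_im_ne_zero {z : ℂ} (hz : z.im ≠ 0) :
    z ∈ Complex.integerComplement := by
  rintro ⟨n, rfl⟩
  simp at hz

/-- The partial fraction expansion of the cotangent, summed symmetrically. -/
lemma tendsto_sum_Icc_cot {z : ℂ} (hz : z ∈ Complex.integerComplement) :
    Tendsto (fun n : ℕ ↦ ∑ q ∈ Finset.Icc (-n : ℤ) n, 1 / (z + q)) atTop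
      (𝓝 (Real.pi * Complex.cot (Real.pi * z))) := by
  have h := (tendsto_logDeriv_euler_cot_sub hz).const_add (1 / z)
  rw [add_sub_cancel] at h
  refine h.congr fun n ↦ ?_
  rw [sum_Icc_neg_eq]
  simp only [Int.cast_zero, add_zero]
  congr 1
  refine Finset.sum_congr rfl fun a _ ↦ ?_
  rw [cotTerm, add_comm]
  push_cast
  rw [← sub_eq_add_neg z]

lemma sum_Ico_int_add {E : Type*} [AddCommMonoid E] (f : ℤ → E) (a : ℤ) (n : ℕ) :
    ∑ x ∈ Finset.Ico a (a + n), f x = ∑ j ∈ Finset.range n, f (a + j) := by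
  induction n with
  | zero => simp
  | succ n ih =>
    have : Finset.Ico a (a + (n + 1 : ℕ)) = insert (a + n) (Finset.Ico a (a + n)) := by
      ext x
      simp only [Finset.mem_Ico, Finset.mem_insert]
      push_cast
      omega
    rw [this, Finset.sum_insert (by simp), ih, Finset.sum_range_succ, add_comm]

lemma sum_Ico_int_mul {E : Type*} [AddCommMonoid E] (f : ℤ → E) (N : ℕ) (u : ℤ) (n : ℕ) :
    ∑ x ∈ Finset.Ico (u * N) ((u + n) * N), f x =
      ∑ q ∈ Finset.Ico u (u + n), ∑ j ∈ Finset.range N, f (q * N + j) := by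
  have h1 : (u + n) * (N : ℤ) = u * N + ((n * N : ℕ) : ℤ) := by push_cast; ring
  rw [h1, sum_Ico_int_add, sum_Ico_int_add]
  induction n with
  | zero => simp
  | succ n ih =>
    rw [add_mul, one_mul, Finset.sum_range_add, ih (by push_cast; ring), Finset.sum_range_succ]
    congr 1
    refine Finset.sum_congr rfl fun j _ ↦ ?_
    congr 1
    push_cast
    ring

/-- The series `∑ χ(a) / (w + a)`, summed symmetrically. Lengths divisible by the modulus suffice
here, and let the sum be split into residue classes. -/
lemma tendsto_sum_Icc_charCot {N : ℕ} [NeZero N] (χ : DirichletCharacter ℂ N) {w : ℂ}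
    (hw : w.im ≠ 0) {u : ℕ → ℕ} (hu : Tendsto u atTop atTop) (hN : ∀ n, N ∣ u n) :
    Tendsto (fun n ↦ ∑ a ∈ Finset.Icc (-(u n) : ℤ) (u n), χ (a : ZMod N) / (w + a)) atTop
      (𝓝 (charCot χ w)) := by
  have hN0 : (N : ℂ) ≠ 0 := NeZero.ne _
  choose v hv using hN
  have hvt : Tendsto v atTop atTop := by
    refine tendsto_atTop.mpr fun b ↦ ?_
    filter_upwards [hu.eventually_ge_atTop (N * b)] with n hn
    rw [hv] at hn
    exact Nat.le_of_mul_le_mul_left hn (NeZero.pos N)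
  have hmain : Tendsto (fun n : ℕ ↦ ∑ a ∈ Finset.Ico (-n * N : ℤ) ((-n + (2 * n + 1 : ℕ)) * N : ℤ),
      χ (a : ZMod N) / (w + a)) atTop (𝓝 (charCot χ w)) := by
    have e : ∀ n : ℕ, ∑ a ∈ Finset.Ico (-n * N : ℤ) ((-n + (2 * n + 1 : ℕ)) * N : ℤ),
        χ (a : ZMod N) / (w + a) = (N : ℂ)⁻¹ * ∑ j ∈ Finset.range N, χ (j : ZMod N) *
          ∑ q ∈ Finset.Icc (-n : ℤ) n, 1 / ((w + j) / N + q) := by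
      intro n
      rw [sum_Ico_int_mul, Finset.sum_comm, Finset.mul_sum]
      refine Finset.sum_congr rfl fun j _ ↦ ?_
      rw [Finset.mul_sum, Finset.mul_sum]
      have : Finset.Ico (-n : ℤ) (-n + (2 * n + 1 : ℕ)) = Finset.Icc (-n : ℤ) n := by
        ext x; simp only [Finset.mem_Ico, Finset.mem_Icc]; push_cast; omega
      rw [this]
      refine Finset.sum_congr rfl fun q _ ↦ ?_
      have h1 : (((q * N + j : ℤ)) : ZMod N) = (j : ZMod N) := by push_cast; simp
      rw [h1, show (w + j) / N + q = (w + ((q * N + j : ℤ) : ℂ)) / N by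
        push_cast; field_simp; ring]
      field_simp
    simp_rw [e]
    refine Tendsto.const_mul _ (tendsto_finsetSum _ fun j _ ↦ Tendsto.const_mul _ ?_)
    refine tendsto_sum_Icc_cot (mem_integerComplement_of_im_ne_zero ?_)
    rw [div_natCast_im, add_im, natCast_im, add_zero]
    exact div_ne_zero hw (NeZero.ne _)
  -- The union of full periods `[-n N, n N + N)` exceeds the symmetric interval by `N - 1` terms,
  -- each of which tends to `0`.
  have htail : Tendsto (fun n : ℕ ↦ ∑ j ∈ Finset.range (N - 1),
      χ (((n * N + 1 + j : ℤ)) : ZMod N) / (w + ((n * N + 1 + j : ℤ) : ℂ))) atTop (𝓝 0) := by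
    rw [← Finset.sum_const_zero (s := Finset.range (N - 1))]
    refine tendsto_finsetSum _ fun j _ ↦ ?_
    have h1 : ∀ n : ℕ, χ (((n * N + 1 + j : ℤ)) : ZMod N) / (w + ((n * N + 1 + j : ℤ) : ℂ)) =
        χ (1 + j) * (w + ((n * N + 1 + j : ℤ) : ℂ))⁻¹ := fun n ↦ by
      rw [div_eq_mul_inv]
      congr 2
      push_cast
      simp
    simp_rw [h1]
    rw [← mul_zero (χ (1 + j))]
    refine Tendsto.const_mul _ (tendsto_inv₀_cobounded.comp
      (tendsto_norm_atTop_iff_cobounded.mp (tendsto_atTop_mono (fun n ↦ re_le_norm _) ?_)))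
    have h2 : ∀ n : ℕ, (w + ((n * N + 1 + j : ℤ) : ℂ)).re = (n : ℝ) * N + (w.re + 1 + j) :=
        fun n ↦ by
      push_cast
      simp
      ring
    simp_rw [h2]
    exact tendsto_atTop_add_const_right _ _ (tendsto_natCast_atTop_atTop.atTop_mul_const
      (Nat.cast_pos.mpr (NeZero.pos N)))
  have := (hmain.comp hvt).sub (htail.comp hvt)
  rw [sub_zero] at this
  refine this.congr fun n ↦ ?_
  simp only [Function.comp_apply]
  have hs : Finset.Ico (-(v n) * N : ℤ) ((-(v n) + (2 * (v n) + 1 : ℕ)) * N : ℤ) =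
      Finset.Icc (-(u n) : ℤ) (u n) ∪
        Finset.Ico ((v n) * N + 1 : ℤ) ((v n) * N + 1 + (N - 1 : ℕ)) := by
    have h1 := NeZero.pos N
    have h2 : ((N - 1 : ℕ) : ℤ) = N - 1 := by omega
    have h3 : (0 : ℤ) ≤ (v n : ℤ) * N := by positivity
    ext x
    rw [h2, hv n]
    simp only [Finset.mem_Ico, Finset.mem_union, Finset.mem_Icc]
    push_cast
    rw [show (-(v n : ℤ) + (2 * v n + 1)) * N = v n * N + N by ring, mul_comm (N : ℤ),
      neg_mul]
    generalize (v n : ℤ) * N = y at *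
    omega
  rw [hs, Finset.sum_union, sum_Ico_int_add, add_sub_cancel_right]
  rw [Finset.disjoint_left]
  intro x
  simp only [Finset.mem_Ico, Finset.mem_Icc, hv n]
  push_cast
  rw [mul_comm (N : ℤ)]
  omega

/-- For nonreal `τ` the modulus of `a τ + b` is bounded below by a multiple of `max |a| |b|`. -/
lemma exists_lower_bound_linear {τ : ℂ} (hτ : τ.im ≠ 0) :
    ∃ c > 0, ∀ a b : ℤ, c * |(a : ℝ)| ≤ ‖(a : ℂ) * τ + b‖ ∧ c * |(b : ℝ)| ≤ ‖(a : ℂ) * τ + b‖ := by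
  have hy : 0 < |τ.im| := abs_pos.mpr hτ
  have h1 : ∀ a b : ℤ, |τ.im| * |(a : ℝ)| ≤ ‖(a : ℂ) * τ + b‖ := fun a b ↦ by
    have := abs_im_le_norm ((a : ℂ) * τ + b)
    simpa [abs_mul, mul_comm] using this
  set r : ℝ := |τ.im| / (|τ.im| + ‖τ‖)
  have hr : 0 < r := by positivity
  have h2 : ∀ a b : ℤ, r * |(b : ℝ)| ≤ ‖(a : ℂ) * τ + b‖ := fun a b ↦ by
    have h3 : |(b : ℝ)| ≤ ‖(a : ℂ) * τ + b‖ + |(a : ℝ)| * ‖τ‖ := by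
      have := norm_sub_le ((a : ℂ) * τ + b) (a * τ)
      simpa [norm_mul] using this
    have h4 := mul_le_mul_of_nonneg_right (h1 a b) (norm_nonneg τ)
    rw [div_mul_eq_mul_div, div_le_iff₀ (by positivity)]
    nlinarith
  refine ⟨min |τ.im| r, lt_min hy hr, fun a b ↦ ⟨?_, ?_⟩⟩
  · exact (mul_le_mul_of_nonneg_right (min_le_left _ _) (abs_nonneg _)).trans (h1 a b)
  · exact (mul_le_mul_of_nonneg_right (min_le_right _ _) (abs_nonneg _)).trans (h2 a b)

/-- The symmetric partial sums of `∑ ψ(b) / (a τ + b)` grow at most like the square root of `|a|`,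
uniformly in the length: compare with `∑ ψ(b) / b`. -/
lemma exists_norm_sum_Icc_le {N : ℕ} [NeZero N] (ψ : DirichletCharacter ℂ N) {τ : ℂ}
    (hτ : τ.im ≠ 0) :
    ∃ C : ℝ, ∀ a : ℤ, a ≠ 0 → ∀ n : ℕ,
      ‖∑ b ∈ Finset.Icc (-n : ℤ) n, ψ (b : ZMod N) / ((a : ℂ) * τ + b)‖ ≤
        C * |(a : ℝ)| ^ (1 / 2 : ℝ) := by
  obtain ⟨c, hc, hcb⟩ := exists_lower_bound_linear hτ
  obtain ⟨K, hK⟩ : ∃ K : ℝ, ∀ n : ℕ,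
      ‖∑ b ∈ Finset.Icc (-n : ℤ) n, ψ (b : ZMod N) / (b : ℂ)‖ ≤ K := by
    have h := (tendsto_sum_Icc_char_div_pow ψ le_rfl).norm.bddAbove_range
    obtain ⟨K, hK⟩ := h
    refine ⟨K, fun n ↦ ?_⟩
    simpa using hK ⟨n, rfl⟩
  have hZ : Summable fun b : ℤ ↦ |(b : ℝ)| ^ (-(3 / 2) : ℝ) :=
    Real.summable_abs_int_rpow (by norm_num)
  set Z := ∑' b : ℤ, |(b : ℝ)| ^ (-(3 / 2) : ℝ)
  refine ⟨c⁻¹ + K + ‖τ‖ / c * Z, fun a ha n ↦ ?_⟩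
  have ha1 : 1 ≤ |(a : ℝ)| := by exact_mod_cast Int.one_le_abs ha
  set A : ℝ := |(a : ℝ)| ^ (1 / 2 : ℝ) with hA
  have hA1 : 1 ≤ A := Real.one_le_rpow ha1 (by norm_num)
  have hAA : A * A = |(a : ℝ)| := by
    rw [hA, ← Real.rpow_add (by positivity)]; norm_num
  have hne : ∀ b : ℤ, (a : ℂ) * τ + b ≠ 0 := fun b h ↦ by
    have := (hcb a b).1
    rw [h, norm_zero] at this
    nlinarith
  have hterm : ∀ b : ℤ, ψ (b : ZMod N) / ((a : ℂ) * τ + b) = (if b = 0 then ψ 0 / (a * τ) else 0) +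
      ψ (b : ZMod N) / (b : ℂ) + ψ (b : ZMod N) * (-(a * τ) / (b * ((a : ℂ) * τ + b))) := by
    intro b
    rcases eq_or_ne b 0 with rfl | hb
    · simp
    · have hb' : (b : ℂ) ≠ 0 := by exact_mod_cast hb
      have := hne b
      rw [if_neg hb]
      field_simp
      ring
  have hbd : ∀ b : ℤ, ‖ψ (b : ZMod N) * (-(a * τ) / (b * ((a : ℂ) * τ + b)))‖ ≤
      ‖τ‖ / c * A * |(b : ℝ)| ^ (-(3 / 2) : ℝ) := by
    intro b
    rcases eq_or_ne b 0 with rfl | hb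
    · simp
    have hb1 : 0 < |(b : ℝ)| := by positivity
    set B : ℝ := |(b : ℝ)| ^ (1 / 2 : ℝ) with hB
    have hB0 : 0 < B := by positivity
    have hBB : B * B = |(b : ℝ)| := by
      rw [hB, ← Real.rpow_add (by positivity)]; norm_num
    have hB3 : |(b : ℝ)| ^ (-(3 / 2) : ℝ) = (B ^ 3)⁻¹ := by
      rw [Real.rpow_neg hb1.le, hB, ← Real.rpow_natCast, ← Real.rpow_mul hb1.le]
      norm_num
    -- The geometric mean of the two lower bounds for `‖a τ + b‖`.
    have hlow : c * (A * B) ≤ ‖(a : ℂ) * τ + b‖ := by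
      obtain ⟨h1, h2⟩ := hcb a b
      rw [← hAA] at h1
      rw [← hBB] at h2
      nlinarith [sq_nonneg (A - B)]
    calc _ ≤ 1 * ‖-(a * τ) / (b * ((a : ℂ) * τ + b))‖ := by
          rw [norm_mul]
          gcongr
          exact ψ.norm_le_one _
      _ = A * A * ‖τ‖ / (B * B * ‖(a : ℂ) * τ + b‖) := by
          rw [hAA, hBB]
          simp
      _ ≤ A * A * ‖τ‖ / (B * B * (c * (A * B))) := by gcongr
      _ = _ := by
          rw [hB3]
          field_simp
  simp_rw [hterm, Finset.sum_add_distrib]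
  have b1 : ‖∑ b ∈ Finset.Icc (-n : ℤ) n, (if b = 0 then ψ 0 / (a * τ) else 0)‖ ≤ c⁻¹ := by
    rw [Finset.sum_ite_eq' , if_pos (by simp), norm_div, div_eq_mul_inv]
    have h1 := (hcb a 0).1
    have h2 : c ≤ ‖(a : ℂ) * τ‖ := by
      rw [Int.cast_zero, add_zero] at h1
      nlinarith
    calc _ ≤ 1 * c⁻¹ := by
          gcongr
          exact ψ.norm_le_one _
      _ = _ := one_mul _
  have b3 : ‖∑ b ∈ Finset.Icc (-n : ℤ) n, ψ (b : ZMod N) * (-(a * τ) / (b * ((a : ℂ) * τ + b)))‖ ≤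
      ‖τ‖ / c * A * Z := by
    refine (norm_sum_le_of_le _ fun b _ ↦ hbd b).trans ?_
    rw [← Finset.mul_sum]
    gcongr
    exact hZ.sum_le_tsum _ fun _ _ ↦ by positivity
  have hK0 : 0 ≤ K := (norm_nonneg _).trans (hK 0)
  have hc0 : 0 < c⁻¹ := by positivity
  calc _ ≤ c⁻¹ + K + ‖τ‖ / c * A * Z := (norm_add₃_le).trans (by gcongr; exact hK n)
    _ ≤ c⁻¹ * A + K * A + ‖τ‖ / c * A * Z := by
        gcongr
        · exact le_mul_of_one_le_right hc0.le hA1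
        · exact le_mul_of_one_le_right hK0 hA1
    _ = _ := by ring

/-- The series `∑ χ(a) a ^ (1 - k) S(a τ)` over the nonzero integers `a`, where `S` is the cotangent
sum of `ψ`; up to the factor `k - 1` it is the Eichler integral of `E_k(τ; χ, ψ)`. The term `a = 0`
vanishes by the convention on division. -/
def cotSeries (k : ℕ) {L M : ℕ} (χ : DirichletCharacter ℂ L) (ψ : DirichletCharacter ℂ M)
    (τ : ℂ) : ℂ :=
  ∑' a : ℤ, χ (a : ZMod L) / (a : ℂ) ^ (k - 1) * charCot ψ (a * τ)

/-- `cotSeries` is the limit of square partial sums of its defining double series. The exponent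
`k - 1 ≥ 2` makes the bound `|a| ^ (1 / 2 - 2)` for the outer terms summable. -/
lemma tendsto_sum_cotSeries {k : ℕ} (hk : 3 ≤ k) {L M : ℕ} [NeZero L] [NeZero M]
    (χ : DirichletCharacter ℂ L) (ψ : DirichletCharacter ℂ M) {τ : ℂ} (hτ : τ.im ≠ 0)
    {u : ℕ → ℕ} (hu : Tendsto u atTop atTop) (hM : ∀ n, M ∣ u n) :
    Tendsto (fun n ↦ ∑ a ∈ Finset.Icc (-(u n) : ℤ) (u n), χ (a : ZMod L) / (a : ℂ) ^ (k - 1) *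
      ∑ b ∈ Finset.Icc (-(u n) : ℤ) (u n), ψ (b : ZMod M) / ((a : ℂ) * τ + b)) atTop
      (𝓝 (cotSeries k χ ψ τ)) := by
  obtain ⟨C, hC⟩ := exists_norm_sum_Icc_le ψ hτ
  simp_rw [fun n ↦ sum_eq_tsum_indicator (fun a : ℤ ↦ χ (a : ZMod L) / (a : ℂ) ^ (k - 1) *
    ∑ b ∈ Finset.Icc (-(u n) : ℤ) (u n), ψ (b : ZMod M) / ((a : ℂ) * τ + b))
    (Finset.Icc (-(u n) : ℤ) (u n))]
  refine tendsto_tsum_of_dominated_convergence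
    (bound := fun a : ℤ ↦ C * |(a : ℝ)| ^ (-(3 / 2) : ℝ))
    ((Real.summable_abs_int_rpow (by norm_num)).mul_left C) (fun a ↦ ?_) (Eventually.of_forall
    fun n a ↦ ?_)
  · rcases eq_or_ne a 0 with rfl | ha
    · have : ((0 : ℤ) : ℂ) ^ (k - 1) = 0 := by simp; omega
      simp only [Set.indicator_apply, this]
      simp
    have : ((a : ℂ) * τ).im ≠ 0 := by simp [ha, hτ]
    refine ((tendsto_sum_Icc_charCot ψ this hu hM).const_mul
      (χ (a : ZMod L) / (a : ℂ) ^ (k - 1))).congr' ?_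
    filter_upwards [hu.eventually_ge_atTop a.natAbs] with n hn
    rw [Set.indicator_of_mem]
    simp only [Finset.coe_Icc, Set.mem_Icc]
    omega
  · have hC0 : 0 ≤ C := by simpa using (norm_nonneg _).trans (hC 1 one_ne_zero 0)
    refine (norm_indicator_le_norm_self _ _).trans ?_
    rcases eq_or_ne a 0 with rfl | ha
    · have : ((0 : ℤ) : ℂ) ^ (k - 1) = 0 := by simp; omega
      simp only [this]
      simp
    have ha1 : 1 ≤ |(a : ℝ)| := by exact_mod_cast Int.one_le_abs ha
    calc _ ≤ 1 / |(a : ℝ)| ^ 2 * (C * |(a : ℝ)| ^ (1 / 2 : ℝ)) := by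
          rw [norm_mul, norm_div, norm_pow, Complex.norm_intCast]
          gcongr
          · exact χ.norm_le_one _
          · omega
          · exact hC a ha _
      _ = _ := by
          rw [← Real.rpow_natCast, one_div, ← Real.rpow_neg (by positivity), mul_left_comm,
            ← Real.rpow_add (by positivity)]
          norm_num

/-! ### The reciprocity law and the functional equation of the cotangent series -/

/-- The geometric expansion in `a τ / b` with remainder. -/
lemma one_div_pow_mul_linear {a b τ : ℂ} (ha : a ≠ 0) (hb : b ≠ 0) (h : a * τ + b ≠ 0) (m : ℕ) :
    1 / (a ^ m * (a * τ + b)) =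
      ∑ j ∈ Finset.range m, (-τ) ^ j * (1 / a ^ (m - j) * (1 / b ^ (j + 1))) +
        (-τ) ^ m / (b ^ m * (a * τ + b)) := by
  induction m with
  | zero => simp
  | succ m ih =>
    have h1 : 1 / (a ^ (m + 1) * (a * τ + b)) = 1 / a * (1 / (a ^ m * (a * τ + b))) := by
      rw [pow_succ]
      field_simp
    rw [h1, ih, mul_add, Finset.mul_sum, Finset.sum_range_succ]
    have h2 : ∀ j ∈ Finset.range m, 1 / a * ((-τ) ^ j * (1 / a ^ (m - j) * (1 / b ^ (j + 1)))) =
        (-τ) ^ j * (1 / a ^ (m + 1 - j) * (1 / b ^ (j + 1))) := by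
      intro j hj
      rw [Nat.succ_sub (Finset.mem_range.mp hj).le, Nat.succ_eq_add_one]
      field_simp
      ring
    rw [Finset.sum_congr rfl h2, add_assoc]
    congr 1
    rw [Nat.add_sub_cancel_left, pow_one]
    field_simp
    ring

/-- The finite form of the reciprocity law. The summand `χ 0 * …` is the term `a = 0`, which only
occurs when `χ` has modulus `1`. -/
lemma sum_Icc_reciprocity {k : ℕ} (hk : 3 ≤ k) {L M : ℕ} (χ : DirichletCharacter ℂ L)
    (ψ : DirichletCharacter ℂ M) (hψ : ψ 0 = 0) {τ : ℂ} (hτ : τ.im ≠ 0) (n : ℕ) :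
    ∑ a ∈ Finset.Icc (-n : ℤ) n, χ (a : ZMod L) / (a : ℂ) ^ (k - 1) *
      ∑ b ∈ Finset.Icc (-n : ℤ) n, ψ (b : ZMod M) / ((a : ℂ) * τ + b) =
    ∑ j ∈ Finset.range (k - 1), (-τ) ^ j *
        ((∑ a ∈ Finset.Icc (-n : ℤ) n, χ (a : ZMod L) / (a : ℂ) ^ (k - 1 - j)) *
        ∑ b ∈ Finset.Icc (-n : ℤ) n, ψ (b : ZMod M) / (b : ℂ) ^ (j + 1)) +
      (-τ) ^ (k - 1) / τ * ∑ b ∈ Finset.Icc (-n : ℤ) n, ψ (b : ZMod M) / (b : ℂ) ^ (k - 1) *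
        ∑ a ∈ Finset.Icc (-n : ℤ) n, χ (a : ZMod L) / ((b : ℂ) * τ⁻¹ + a) -
      χ 0 * (-τ) ^ (k - 1) * ∑ b ∈ Finset.Icc (-n : ℤ) n, ψ (b : ZMod M) / (b : ℂ) ^ k := by
  obtain ⟨c, hc, hcb⟩ := exists_lower_bound_linear hτ
  have hτ0 : τ ≠ 0 := by rintro rfl; simp at hτ
  have key : ∀ a b : ℤ, χ (a : ZMod L) / (a : ℂ) ^ (k - 1) * (ψ (b : ZMod M) / ((a : ℂ) * τ + b)) =
      ∑ j ∈ Finset.range (k - 1), (-τ) ^ j * ((χ (a : ZMod L) / (a : ℂ) ^ (k - 1 - j)) *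
        (ψ (b : ZMod M) / (b : ℂ) ^ (j + 1))) +
      (-τ) ^ (k - 1) / τ * (ψ (b : ZMod M) / (b : ℂ) ^ (k - 1) *
        (χ (a : ZMod L) / ((b : ℂ) * τ⁻¹ + a))) -
      (if a = 0 then χ 0 * (-τ) ^ (k - 1) * (ψ (b : ZMod M) / (b : ℂ) ^ k) else 0) := by
    intro a b
    rcases eq_or_ne b 0 with rfl | hb
    · simp [hψ]
    have hb' : (b : ℂ) ≠ 0 := by exact_mod_cast hb
    rcases eq_or_ne a 0 with rfl | ha
    · have h0 : ∀ j ∈ Finset.range (k - 1), (-τ) ^ j *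
          ((χ ((0 : ℤ) : ZMod L) / ((0 : ℤ) : ℂ) ^ (k - 1 - j)) *
          (ψ (b : ZMod M) / (b : ℂ) ^ (j + 1))) = 0 := by
        intro j hj
        have := Finset.mem_range.mp hj
        simp [show k - 1 - j ≠ 0 by omega]
      rw [Finset.sum_eq_zero h0, if_pos rfl]
      obtain ⟨m, rfl⟩ : ∃ m, k = m + 1 := ⟨k - 1, by omega⟩
      have hm : m ≠ 0 := by omega
      simp only [Int.cast_zero, add_tsub_cancel_right, zero_pow hm, div_zero, zero_mul,
        zero_add, add_zero]
      rw [pow_succ (b : ℂ) m]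
      field_simp
      simp
    · have ha' : (a : ℂ) ≠ 0 := by exact_mod_cast ha
      have hne : (a : ℂ) * τ + b ≠ 0 := fun h ↦ by
        have h1 := (hcb a b).1
        rw [h, norm_zero] at h1
        have h2 : 0 < |(a : ℝ)| := by positivity
        nlinarith
      have h3 : (b : ℂ) * τ⁻¹ + a = (a * τ + b) / τ := by field_simp; ring
      have h4 : χ (a : ZMod L) / (a : ℂ) ^ (k - 1) * (ψ (b : ZMod M) / ((a : ℂ) * τ + b)) =
          χ (a : ZMod L) * ψ (b : ZMod M) * (1 / ((a : ℂ) ^ (k - 1) * (a * τ + b))) := by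
        field_simp
      rw [if_neg ha, sub_zero, h3, h4, one_div_pow_mul_linear ha' hb' hne, mul_add, Finset.mul_sum]
      congr 1
      · refine Finset.sum_congr rfl fun j _ ↦ ?_
        ring
      · field_simp
  simp_rw [Finset.mul_sum, key, Finset.sum_sub_distrib, Finset.sum_add_distrib]
  congr 1
  · congr 1
    · simp_rw [Finset.sum_comm (s := Finset.Icc (-n : ℤ) n) (t := Finset.range (k - 1))]
      refine Finset.sum_congr rfl fun j _ ↦ ?_
      rw [Finset.sum_comm]
      refine Finset.sum_congr rfl fun b _ ↦ ?_
      rw [Finset.sum_mul, Finset.mul_sum]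
    · rw [Finset.sum_comm]
  · rw [Finset.sum_comm]
    refine Finset.sum_congr rfl fun b _ ↦ ?_
    rw [Finset.sum_ite_eq', if_pos (by simp)]

/-- The reciprocity law relating `τ` and `τ⁻¹`, with the `L`-values as coefficients. -/
lemma cotSeries_reciprocity {k : ℕ} (hk : 3 ≤ k) {L M : ℕ} [NeZero L] [NeZero M]
    (χ : DirichletCharacter ℂ L) (ψ : DirichletCharacter ℂ M) (hψ : ψ 0 = 0) {τ : ℂ}
    (hτ : τ.im ≠ 0) :
    cotSeries k χ ψ τ =
    ∑ j ∈ Finset.range (k - 1), (-τ) ^ j *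
        (((1 + χ (-1) * (-1) ^ (k - 1 - j)) * χ.LFunction (k - 1 - j : ℕ)) *
        ((1 + ψ (-1) * (-1) ^ (j + 1)) * ψ.LFunction (j + 1 : ℕ))) +
      (-τ) ^ (k - 1) / τ * cotSeries k ψ χ τ⁻¹ -
      χ 0 * (-τ) ^ (k - 1) * ((1 + ψ (-1) * (-1) ^ k) * ψ.LFunction k) := by
  -- Lengths divisible by both moduli, as needed by the inner sums on either side.
  set u : ℕ → ℕ := fun n ↦ n * (L * M)
  have hu : Tendsto u atTop atTop :=
    tendsto_id.atTop_mul_const' (Nat.mul_pos (NeZero.pos L) (NeZero.pos M))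
  have hτ' : (τ⁻¹).im ≠ 0 := by
    rw [inv_im]
    have : τ ≠ 0 := by rintro rfl; simp at hτ
    exact div_ne_zero (neg_ne_zero.mpr hτ) (by simpa)
  refine tendsto_nhds_unique (tendsto_sum_cotSeries hk χ ψ hτ hu fun n ↦ ?_) ?_
  · exact Dvd.intro_left (n * L) (mul_assoc _ _ _)
  simp_rw [sum_Icc_reciprocity hk χ ψ hψ hτ]
  refine ((tendsto_finsetSum _ fun j hj ↦ Tendsto.const_mul _ (Tendsto.mul ?_ ?_)).add
    (Tendsto.const_mul _ (tendsto_sum_cotSeries hk ψ χ hτ' hu fun n ↦ ?_))).sub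
    (Tendsto.const_mul _ ?_)
  · have := Finset.mem_range.mp hj
    exact (tendsto_sum_Icc_char_div_pow χ (by omega)).comp hu
  · exact (tendsto_sum_Icc_char_div_pow ψ (by omega)).comp hu
  · exact ⟨n * M, by simp only [u]; ring⟩
  · exact (tendsto_sum_Icc_char_div_pow ψ (by omega)).comp hu

lemma charCot_add_mul_int {N : ℕ} [NeZero N] (χ : DirichletCharacter ℂ N) (w : ℂ) (q : ℤ) :
    charCot χ (w + N * q) = charCot χ w := by
  have hN0 : (N : ℂ) ≠ 0 := NeZero.ne _
  simp only [charCot]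
  congr 1
  refine Finset.sum_congr rfl fun j _ ↦ ?_
  have : Real.pi * ((w + N * q + j) / N) = Real.pi * ((w + j) / N) + q * (Real.pi : ℂ) := by
    field_simp
    ring
  rw [this, ← Complex.tan_inv_eq_cot, ← Complex.tan_inv_eq_cot, Complex.tan_add_int_mul_pi]

lemma cotSeries_add_int (k : ℕ) {L M : ℕ} [NeZero L]
    (χ : DirichletCharacter ℂ L) (ψ : DirichletCharacter ℂ M) (w : ℂ) {n : ℤ} (hn : (L : ℤ) ∣ n) :
    cotSeries k ψ χ (w + n) = cotSeries k ψ χ w := by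
  obtain ⟨q, rfl⟩ := hn
  refine tsum_congr fun b ↦ ?_
  rw [← charCot_add_mul_int χ (b * w) (b * q)]
  congr 2
  push_cast
  ring

/-- The Laurent polynomial `-4 ψ(-1) ∑ L(s, χ) L(k - s, ψ) τ ^ (k - s - 1)` whose coboundary is the
right-hand side of the functional equation of `cotSeries`. -/
def periodSum (k : ℕ) {L M : ℕ} [NeZero L] [NeZero M] (χ : DirichletCharacter ℂ L)
    (ψ : DirichletCharacter ℂ M) (τ : ℂ) : ℂ :=
  -(4 * ψ (-1)) * ∑ s ∈ Finset.range (k + 1) with χ (-1) = (-1) ^ s,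
    χ.LFunction (s : ℂ) * ψ.LFunction ((k : ℂ) - (s : ℂ)) * τ ^ ((k : ℤ) - (s : ℤ) - 1)

lemma char_neg_one_eq_or {N : ℕ} (χ : DirichletCharacter ℂ N) : χ (-1) = 1 ∨ χ (-1) = -1 := by
  have h : χ (-1) * χ (-1) = 1 := by rw [← map_mul]; simp
  exact mul_self_eq_one_iff.mp h

/-- `L(0, χ)` for even primitive `χ` is `-1 / 2` for the character modulo `1` and `0` otherwise. -/
lemma LFunction_zero_of_even {N : ℕ} [NeZero N] {χ : DirichletCharacter ℂ N}
    (hχ : χ.IsPrimitive) (he : χ (-1) = 1) : χ.LFunction 0 = -χ 0 / 2 := by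
  by_cases h : χ = 1
  · have hN : N = 1 := by
      rw [DirichletCharacter.isPrimitive_def, h, DirichletCharacter.conductor_one] at hχ
      exact hχ.symm
    subst hN
    rw [DirichletCharacter.LFunction_modOne_eq, riemannZeta_zero, show (0 : ZMod 1) = 1 from rfl,
      map_one]
  · have hN : N ≠ 1 := by rintro rfl; exact h (Subsingleton.elim _ _)
    have hN' : Fact (1 < N) := ⟨by have := NeZero.pos N; omega⟩
    have h0 : χ 0 = 0 := χ.map_nonunit not_isUnit_zero
    rw [h0, neg_zero, zero_div]
    have hev : Function.Even χ := DirichletCharacter.Even.to_fun he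
    rw [DirichletCharacter.LFunction, ZMod.LFunction_apply_zero_of_even hev, h0]
    simp

/-- The rational function in the reciprocity law, rewritten as a sum over `0 ≤ s ≤ k`: the terms
`1 ≤ s ≤ k - 1` come from `j = k - 1 - s`, the term `s = 0` from `a = 0`, and the term `s = k`
vanishes because `L(0, ψ) = 0` for even nontrivial `ψ`. -/
lemma reciprocity_polynomial_eq_periodSum {k : ℕ} (hk : 3 ≤ k) {L M : ℕ} [NeZero L] [NeZero M]
    {χ : DirichletCharacter ℂ L} {ψ : DirichletCharacter ℂ M} (hχ : χ.IsPrimitive)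
    (hψ : ψ.IsPrimitive) (hpar : χ (-1) * ψ (-1) = (-1) ^ k) (hψ0 : ψ 0 = 0) (τ : ℂ) :
    ∑ j ∈ Finset.range (k - 1), (-τ) ^ j *
        (((1 + χ (-1) * (-1) ^ (k - 1 - j)) * χ.LFunction (k - 1 - j : ℕ)) *
        ((1 + ψ (-1) * (-1) ^ (j + 1)) * ψ.LFunction (j + 1 : ℕ))) -
      χ 0 * (-τ) ^ (k - 1) * ((1 + ψ (-1) * (-1) ^ k) * ψ.LFunction k) = periodSum k χ ψ τ := by
  obtain ⟨m, rfl⟩ : ∃ m, k = m + 1 := ⟨k - 1, by omega⟩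
  have hψk : ψ (-1) = χ (-1) * (-1) ^ (m + 1) := by
    rw [← hpar, ← mul_assoc]
    rcases char_neg_one_eq_or χ with h | h <;> simp [h]
  rw [periodSum, Finset.sum_filter, Finset.sum_range_succ, Finset.sum_range_succ', mul_add, mul_add]
  have hk' : (if χ (-1) = (-1) ^ (m + 1) then χ.LFunction ((m + 1 : ℕ) : ℂ) *
      ψ.LFunction (((m + 1 : ℕ) : ℂ) - ((m + 1 : ℕ) : ℂ)) *
      τ ^ (((m + 1 : ℕ) : ℤ) - ((m + 1 : ℕ) : ℤ) - 1) else 0) = 0 := by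
    split_ifs with h
    · have : ψ (-1) = 1 := by rw [hψk, h, ← mul_pow]; simp
      rw [sub_self, LFunction_zero_of_even hψ this, hψ0]
      simp
    · rfl
  rw [hk', mul_zero, add_zero, sub_eq_add_neg]
  congr 1
  · rw [Nat.add_sub_cancel, ← Finset.sum_range_reflect, Finset.mul_sum]
    refine Finset.sum_congr rfl fun s hs ↦ ?_
    have hs := Finset.mem_range.mp hs
    obtain ⟨i, rfl⟩ : ∃ i, m = s + 1 + i := Nat.exists_eq_add_of_le hs
    have e1 : s + 1 + i - 1 - s = i := by omega
    have e2 : s + 1 + i - i = s + 1 := by omega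
    have e3 : ((s + 1 + i + 1 : ℕ) : ℂ) - ((s + 1 : ℕ) : ℂ) = ((i + 1 : ℕ) : ℂ) := by
      push_cast; ring
    have e4 : ((s + 1 + i + 1 : ℕ) : ℤ) - ((s + 1 : ℕ) : ℤ) - 1 = (i : ℕ) := by
      push_cast; ring
    rw [e1, e2, e3, e4, zpow_natCast, hψk, neg_pow τ]
    rw [show (-1 : ℂ) ^ (s + 1 + i + 1) = -((-1) ^ (s + 1) * (-1) ^ i) by ring,
      pow_succ (-1 : ℂ) i]
    generalize χ.LFunction ((s + 1 : ℕ) : ℂ) = x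
    generalize ψ.LFunction ((i + 1 : ℕ) : ℂ) = y
    rcases char_neg_one_eq_or χ with h1 | h1 <;>
    rcases neg_one_pow_eq_or ℂ (s + 1) with h2 | h2 <;>
    rcases neg_one_pow_eq_or ℂ i with h3 | h3 <;>
    rw [h1, h2, h3] <;> norm_num <;> ring
  · simp only [Nat.cast_zero, pow_zero, sub_zero]
    split_ifs with h
    · rw [LFunction_zero_of_even hχ h, hψk, h, one_mul]
      have hsi : ((-1 : ℂ) ^ (m + 1)) * (-1) ^ (m + 1) = 1 := by rw [← mul_pow]; simp
      rw [hsi, show (((m + 1 : ℕ) : ℤ) - 1) = (m : ℕ) by push_cast; ring, zpow_natCast,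
        Nat.add_sub_cancel, neg_pow τ, pow_succ (-1 : ℂ) m]
      ring
    · have h1 : χ ≠ 1 := by
        rintro rfl
        exact h (MulChar.one_apply isUnit_one.neg)
      have hN : L ≠ 1 := by rintro rfl; exact h1 (Subsingleton.elim _ _)
      have hN' : Fact (1 < L) := ⟨by have := NeZero.pos L; omega⟩
      rw [χ.map_nonunit not_isUnit_zero]
      simp

/-- The functional equation: `cotSeries k ψ χ τ⁻¹` is unchanged when `τ⁻¹` is replaced by
`τ⁻¹ + n`, so that only the rational function in the reciprocity law contributes. -/
lemma cotSeries_sub_slash {k : ℕ} (hk : 3 ≤ k) {L M : ℕ} [NeZero L] [NeZero M]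
    {χ : DirichletCharacter ℂ L} {ψ : DirichletCharacter ℂ M} (hχ : χ.IsPrimitive)
    (hψ : ψ.IsPrimitive) (hpar : χ (-1) * ψ (-1) = (-1) ^ k) (hψ1 : ψ ≠ 1) {τ : ℂ}
    (hτ : τ.im ≠ 0) {n : ℤ} (hn : (L : ℤ) ∣ n) :
    cotSeries k χ ψ τ - (n * τ + 1) ^ (k - 2) * cotSeries k χ ψ (τ / (n * τ + 1)) =
      -(4 * ψ (-1)) * ∑ s ∈ Finset.range (k + 1) with χ (-1) = (-1) ^ s,
        χ.LFunction (s : ℂ) * ψ.LFunction ((k : ℂ) - (s : ℂ)) * τ ^ ((k : ℤ) - (s : ℤ) - 1) *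
          (1 - (n * τ + 1) ^ ((s : ℤ) - 1)) := by
  have hM : M ≠ 1 := by rintro rfl; exact hψ1 (Subsingleton.elim _ _)
  have hM' : Fact (1 < M) := ⟨by have := NeZero.pos M; omega⟩
  have hψ0 : ψ 0 = 0 := ψ.map_nonunit not_isUnit_zero
  have hτ0 : τ ≠ 0 := by rintro rfl; simp at hτ
  set d : ℂ := n * τ + 1 with hd
  have hd0 : d ≠ 0 := by
    intro h
    have h1 := congrArg Complex.im h
    simp only [hd, add_im, mul_im, intCast_re, intCast_im, zero_mul, add_zero, one_im, zero_im,
      mul_eq_zero, hτ, or_false, Int.cast_eq_zero] at h1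
    simp [hd, h1] at h
  have hinv : (τ / d)⁻¹ = τ⁻¹ + n := by
    rw [inv_div, hd]; field_simp; ring
  have hτ' : (τ / d).im ≠ 0 := by
    have h1 : ((τ / d)⁻¹).im ≠ 0 := by
      rw [hinv, add_im, intCast_im, add_zero, inv_im]
      exact div_ne_zero (neg_ne_zero.mpr hτ) (by simpa)
    intro h
    rw [inv_im, h] at h1
    simp at h1
  have r1 := cotSeries_reciprocity hk χ ψ hψ0 hτ
  have r2 := cotSeries_reciprocity hk χ ψ hψ0 hτ'
  rw [add_sub_right_comm, reciprocity_polynomial_eq_periodSum hk hχ hψ hpar hψ0] at r1 r2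
  rw [hinv, cotSeries_add_int k χ ψ _ hn] at r2
  have h3 : d ^ (k - 2) * ((-(τ / d)) ^ (k - 1) / (τ / d)) = (-τ) ^ (k - 1) / τ := by
    obtain ⟨m, rfl⟩ : ∃ m, k = m + 2 := ⟨k - 2, by omega⟩
    rw [← neg_div, div_pow, show m + 2 - 1 = m + 1 by omega, Nat.add_sub_cancel, pow_succ d]
    field_simp
  have h4 : d ^ (k - 2) * periodSum k χ ψ (τ / d) =
      -(4 * ψ (-1)) * ∑ s ∈ Finset.range (k + 1) with χ (-1) = (-1) ^ s,
        χ.LFunction (s : ℂ) * ψ.LFunction ((k : ℂ) - (s : ℂ)) * (τ ^ ((k : ℤ) - (s : ℤ) - 1) *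
          d ^ ((s : ℤ) - 1)) := by
    rw [periodSum, mul_left_comm]
    congr 1
    rw [Finset.mul_sum]
    refine Finset.sum_congr rfl fun s _ ↦ ?_
    have h5 : d ^ (k - 2) * (τ / d) ^ ((k : ℤ) - s - 1) =
        τ ^ ((k : ℤ) - s - 1) * d ^ ((s : ℤ) - 1) := by
      rw [div_zpow, ← zpow_natCast, div_eq_mul_inv, ← zpow_neg, mul_left_comm, ← zpow_add₀ hd0]
      congr 2
      push_cast [show 2 ≤ k by omega]
      ring
    rw [← h5]
    ring
  rw [r1, r2, mul_add, h4, ← mul_assoc, h3, periodSum, add_sub_add_right_eq_sub, ← mul_sub,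
    ← Finset.sum_sub_distrib]
  congr 1
  refine Finset.sum_congr rfl fun s _ ↦ ?_
  ring

/-! ### Fourier expansion of the Eisenstein series -/

/-- The discrete Fourier transform `∑ j, ψ(j) exp(2 π i j r / M)` of the character `ψ`. -/
def charDFT {M : ℕ} (ψ : DirichletCharacter ℂ M) (r : ℕ) : ℂ :=
  ∑ j ∈ Finset.range M, ψ (j : ZMod M) * cexp (2 * Real.pi * I * (j / M)) ^ r

lemma norm_charDFT_le {M : ℕ} (ψ : DirichletCharacter ℂ M) (r : ℕ) : ‖charDFT ψ r‖ ≤ M := by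
  refine (norm_sum_le _ _).trans ?_
  calc _ ≤ ∑ j ∈ Finset.range M, (1 : ℝ) := Finset.sum_le_sum fun j _ ↦ by
        have : (2 * Real.pi * I * (j / M) : ℂ) = ((2 * Real.pi * (j / M) : ℝ) : ℂ) * I := by
          push_cast; ring
        rw [norm_mul, norm_pow, this, norm_exp_ofReal_mul_I, one_pow, mul_one]
        exact ψ.norm_le_one _
    _ = M := by simp

lemma charDFT_zero {M : ℕ} [NeZero M] {ψ : DirichletCharacter ℂ M} (hψ : ψ ≠ 1) :
    charDFT ψ 0 = 0 := by
  simp only [charDFT, pow_zero, mul_one]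
  rw [sum_range_zmod (fun j ↦ ψ j), MulChar.sum_eq_zero_of_ne_one hψ]

lemma exp_add_div {M : ℕ} (w : ℂ) (j r : ℕ) : cexp (2 * Real.pi * I * ((w + j) / M)) ^ r =
    cexp (2 * Real.pi * I * (j / M)) ^ r * cexp (2 * Real.pi * I * (w / M)) ^ r := by
  rw [← mul_pow, ← Complex.exp_add]
  ring_nf

lemma im_add_div_pos {M : ℕ} [NeZero M] {w : ℂ} (hw : 0 < w.im) (j : ℕ) :
    0 < ((w + j) / M).im := by
  rw [div_natCast_im, add_im, natCast_im, add_zero]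
  exact div_pos hw (Nat.cast_pos.mpr (NeZero.pos M))

/-- The Fourier expansion of the cotangent sum; its constant term `∑ ψ(j)` vanishes. -/
lemma hasSum_charCot {M : ℕ} [NeZero M] {ψ : DirichletCharacter ℂ M} (hψ : ψ ≠ 1) {w : ℂ}
    (hw : 0 < w.im) :
    HasSum (fun r : ℕ ↦ -(2 * Real.pi * I) / M *
      (charDFT ψ r * cexp (2 * Real.pi * I * (w / M)) ^ r)) (charCot ψ w) := by
  have hcot : ∀ j : ℕ, HasSum (fun r : ℕ ↦
      ψ (j : ZMod M) * cexp (2 * Real.pi * I * ((w + j) / M)) ^ r)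
      (ψ (j : ZMod M) * ((Real.pi * I - Real.pi * Complex.cot (Real.pi * ((w + j) / M))) /
        (2 * Real.pi * I))) := by
    intro j
    set z : ℍ := ⟨(w + j) / M, im_add_div_pos hw j⟩ with hz
    have h1 := pi_mul_cot_pi_q_exp z
    have h2 := (summable_geometric_iff_norm_lt_one.mpr
      (UpperHalfPlane.norm_exp_two_pi_I_lt_one z)).hasSum
    have hz' : (z : ℂ) = (w + j) / M := rfl
    rw [hz'] at h1 h2
    rw [show (Real.pi * I - Real.pi * Complex.cot (Real.pi * ((w + j) / M))) / (2 * Real.pi * I) =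
      ∑' n : ℕ, cexp (2 * Real.pi * I * ((w + j) / M)) ^ n by
        rw [h1]
        have := Complex.two_pi_I_ne_zero
        field_simp
        ring]
    exact h2.mul_left _
  have h := (hasSum_sum (s := Finset.range M) fun j _ ↦ hcot j).mul_left (-(2 * Real.pi * I) / M)
  have h0 : ∑ j ∈ Finset.range M, ψ (j : ZMod M) = 0 := by
    rw [sum_range_zmod (fun j ↦ ψ j), MulChar.sum_eq_zero_of_ne_one hψ]
  have hM : (M : ℂ) ≠ 0 := NeZero.ne _
  have e : ∀ j ∈ Finset.range M, ψ (j : ZMod M) *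
      ((Real.pi * I - Real.pi * Complex.cot (Real.pi * ((w + j) / M))) / (2 * Real.pi * I)) =
      ψ (j : ZMod M) * (1 / 2) - (2 * Real.pi * I)⁻¹ *
      (ψ (j : ZMod M) * (Real.pi * Complex.cot (Real.pi * ((w + j) / M)))) := by
    intro j _
    have := Complex.two_pi_I_ne_zero
    field_simp
  have e' : -(2 * Real.pi * I) / M * ∑ j ∈ Finset.range M, ψ (j : ZMod M) *
      ((Real.pi * I - Real.pi * Complex.cot (Real.pi * ((w + j) / M))) / (2 * Real.pi * I)) =
      charCot ψ w := by
    rw [Finset.sum_congr rfl e, Finset.sum_sub_distrib, ← Finset.sum_mul, h0, ← Finset.mul_sum,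
      charCot, zero_mul, zero_sub]
    have := Complex.two_pi_I_ne_zero
    generalize ∑ j ∈ Finset.range M, ψ (j : ZMod M) *
      (Real.pi * Complex.cot (Real.pi * ((w + j) / M))) = x
    field_simp
  rw [← e']
  refine h.congr_fun fun r ↦ ?_
  rw [charDFT, Finset.sum_mul]
  congr 1
  refine Finset.sum_congr rfl fun j _ ↦ ?_
  rw [exp_add_div]
  ring

lemma summable_char_div_pow {M : ℕ} (ψ : DirichletCharacter ℂ M) (w : ℂ) {k : ℕ} (hk : 2 ≤ k) :
    Summable fun b : ℤ ↦ ψ (b : ZMod M) / (w + b) ^ k := by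
  have h := EisensteinSeries.linear_right_summable w 1 (k := k) (by exact_mod_cast hk)
  refine Summable.of_norm_bounded h.norm fun b ↦ ?_
  simp only [Int.cast_one, one_mul, zpow_natCast]
  rw [norm_div, norm_inv, ← one_div]
  gcongr
  exact ψ.norm_le_one _

/-- The Lipschitz formula twisted by a character. -/
lemma tsum_char_div_pow {M : ℕ} [NeZero M] (ψ : DirichletCharacter ℂ M) {w : ℂ}
    (hw : 0 < w.im) {k : ℕ} (hk : 2 ≤ k) :
    ∑' b : ℤ, ψ (b : ZMod M) / (w + b) ^ k =
      (-2 * Real.pi * I) ^ k / (k - 1).factorial / M ^ k *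
        ∑' r : ℕ, (r : ℂ) ^ (k - 1) * (charDFT ψ r * cexp (2 * Real.pi * I * (w / M)) ^ r) := by
  obtain ⟨m, rfl⟩ : ∃ m, k = m + 1 := ⟨k - 1, by omega⟩
  have hM : (M : ℂ) ≠ 0 := NeZero.ne _
  have hs := summable_char_div_pow ψ w hk
  -- Split the sum over `b = q M + j` into residue classes `j`.
  rw [← (Int.divModEquiv M).symm.tsum_eq]
  have hs' := (Int.divModEquiv M).symm.summable_iff.mpr hs
  have hs'' : Summable fun c : Fin M × ℤ ↦ ψ (((Int.divModEquiv M).symm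
      ((Equiv.prodComm (Fin M) ℤ) c) : ℤ) : ZMod M) /
      (w + ((Int.divModEquiv M).symm ((Equiv.prodComm (Fin M) ℤ) c) : ℤ)) ^ (m + 1) :=
    (Equiv.prodComm (Fin M) ℤ).summable_iff.mpr hs'
  rw [← (Equiv.prodComm (Fin M) ℤ).tsum_eq, Summable.tsum_prod hs'', tsum_fintype]
  have e : ∀ j : Fin M, ∑' q : ℤ, ψ (((Int.divModEquiv M).symm
      ((Equiv.prodComm (Fin M) ℤ) (j, q)) : ℤ) : ZMod M) /
      (w + ((Int.divModEquiv M).symm ((Equiv.prodComm (Fin M) ℤ) (j, q)) : ℤ)) ^ (m + 1) =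
      ψ ((j : ℕ) : ZMod M) * (((M : ℂ) ^ (m + 1))⁻¹ * ((-2 * Real.pi * I) ^ (m + 1) / m.factorial *
      ∑' r : ℕ, (r : ℂ) ^ m * cexp (2 * Real.pi * I * ((w + (j : ℕ)) / M)) ^ r)) := by
    intro j
    have h1 := EisensteinSeries.qExpansion_identity (k := m) (by omega)
      ⟨(w + (j : ℕ)) / M, im_add_div_pos hw j⟩
    rw [UpperHalfPlane.coe_mk] at h1
    rw [← h1, ← tsum_mul_left, ← tsum_mul_left]
    refine tsum_congr fun q ↦ ?_
    simp only [Equiv.prodComm_apply, Prod.swap_prod_mk, Int.divModEquiv_symm_apply]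
    push_cast
    rw [show w + (q * M + (j : ℕ)) = M * ((w + (j : ℕ)) / M + q) by field_simp; ring, mul_pow]
    simp
    field_simp
  have hsum : ∀ j : ℕ, Summable fun r : ℕ ↦
      (r : ℂ) ^ m * cexp (2 * Real.pi * I * ((w + j) / M)) ^ r := fun j ↦
    summable_pow_mul_geometric_of_norm_lt_one m
      (UpperHalfPlane.norm_exp_two_pi_I_lt_one ⟨(w + j) / M, im_add_div_pos hw j⟩)
  rw [Finset.sum_congr rfl fun j _ ↦ e j]
  rw [Fin.sum_univ_eq_sum_range (fun j : ℕ ↦ ψ (j : ZMod M) * (((M : ℂ) ^ (m + 1))⁻¹ *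
    ((-2 * Real.pi * I) ^ (m + 1) / m.factorial *
      ∑' r : ℕ, (r : ℂ) ^ m * cexp (2 * Real.pi * I * ((w + j) / M)) ^ r)))]
  have e2 : ∀ r : ℕ, (r : ℂ) ^ (m + 1 - 1) *
      (charDFT ψ r * cexp (2 * Real.pi * I * (w / M)) ^ r) =
      ∑ j ∈ Finset.range M, ψ (j : ZMod M) *
        ((r : ℂ) ^ m * cexp (2 * Real.pi * I * ((w + j) / M)) ^ r) := by
    intro r
    rw [charDFT, Finset.sum_mul, Finset.mul_sum]
    refine Finset.sum_congr rfl fun j _ ↦ ?_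
    rw [exp_add_div, Nat.add_sub_cancel]
    ring
  simp_rw [e2]
  rw [Summable.tsum_finsetSum fun j _ ↦ (hsum j).mul_left _, Finset.mul_sum]
  refine Finset.sum_congr rfl fun j _ ↦ ?_
  rw [tsum_mul_left, Nat.add_sub_cancel]
  ring

lemma summable_eisensteinTerm {k : ℕ} (hk : 3 ≤ k) {L M : ℕ} (χ : DirichletCharacter ℂ L)
    (ψ : DirichletCharacter ℂ M) (τ : ℍ) : Summable (eisensteinTerm k χ ψ τ) := by
  have h := EisensteinSeries.summable_norm_eisSummand (k := k) (by exact_mod_cast hk) τ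
  rw [← (finTwoArrowEquiv ℤ).symm.summable_iff] at h
  refine Summable.of_norm_bounded h fun p ↦ ?_
  simp only [Function.comp_apply, eisensteinTerm, EisensteinSeries.eisSummand]
  split_ifs
  · simp
  · simp only [finTwoArrowEquiv_symm_apply, Matrix.cons_val_zero, Matrix.cons_val_one, zpow_neg,
      zpow_natCast, norm_div, norm_inv, norm_mul]
    rw [div_eq_mul_inv]
    refine mul_le_of_le_one_left (by positivity) ?_
    exact mul_le_one₀ (χ.norm_le_one _) (norm_nonneg _) (ψ.norm_le_one _)

/-- The constant term `χ(0) ∑ ψ(b) / b ^ k` of the Eisenstein series; it vanishes unless `χ` has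
modulus `1`. -/
def eisensteinConst (k : ℕ) {L M : ℕ} (χ : DirichletCharacter ℂ L)
    (ψ : DirichletCharacter ℂ M) : ℂ := χ 0 * ∑' b : ℤ, ψ (b : ZMod M) / (b : ℂ) ^ k

/-- The `(a + 1, r)`-term of the Fourier expansion of `E_k(z; χ, ψ)`, up to a constant factor. -/
def fourierTerm (k : ℕ) {L M : ℕ} (χ : DirichletCharacter ℂ L) (ψ : DirichletCharacter ℂ M)
    (z : ℂ) (p : ℕ × ℕ) : ℂ :=
  χ ((p.1 + 1 : ℕ) : ZMod L) * ((p.2 : ℂ) ^ (k - 1) * (charDFT ψ p.2 *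
    cexp (2 * Real.pi * I * ((p.1 + 1 : ℕ) * z / M)) ^ p.2))

/-- A summable majorant of the Fourier terms at height at least `y`. -/
def fourierBound (k M : ℕ) (y : ℝ) (p : ℕ × ℕ) : ℝ :=
  Real.exp (-(2 * Real.pi * y / M)) ^ p.1 *
    (M * ((p.2 : ℝ) ^ (k - 1) * Real.exp (-(2 * Real.pi * y / M)) ^ p.2))

lemma summable_fourierBound (k : ℕ) {M : ℕ} [NeZero M] {y : ℝ} (hy : 0 < y) :
    Summable (fourierBound k M y) := by
  have hM : (0 : ℝ) < M := Nat.cast_pos.mpr (NeZero.pos M)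
  have h1 : Real.exp (-(2 * Real.pi * y / M)) < 1 := by
    rw [Real.exp_lt_one_iff]
    have : 0 < 2 * Real.pi * y / M := by positivity
    linarith
  have h0 : 0 ≤ Real.exp (-(2 * Real.pi * y / M)) := (Real.exp_pos _).le
  unfold fourierBound
  generalize Real.exp (-(2 * Real.pi * y / M)) = ρ at h0 h1 ⊢
  have hρ : ‖ρ‖ < 1 := by rwa [Real.norm_of_nonneg h0]
  have h2 := (summable_pow_mul_geometric_of_norm_lt_one (k - 1) hρ).mul_left (M : ℝ)
  exact Summable.mul_of_nonneg (summable_geometric_of_lt_one h0 h1) h2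
    (fun a ↦ pow_nonneg h0 a) fun r ↦
      mul_nonneg hM.le (mul_nonneg (by positivity) (pow_nonneg h0 r))

/-- The Fourier terms at `z` decay like `exp (-2 π (Im z - y) / M)` relative to the bound at
height `y`. -/
lemma norm_fourierTerm_le {k : ℕ} (hk : 2 ≤ k) {L M : ℕ} [NeZero M] (χ : DirichletCharacter ℂ L)
    (ψ : DirichletCharacter ℂ M) {z : ℂ} {y : ℝ} (hy : 0 < y) (hz : y ≤ z.im) (p : ℕ × ℕ) :
    ‖fourierTerm k χ ψ z p‖ ≤
      fourierBound k M y p * Real.exp (-(2 * Real.pi * (z.im - y) / M)) := by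
  obtain ⟨a, r⟩ := p
  have hM : (0 : ℝ) < M := Nat.cast_pos.mpr (NeZero.pos M)
  rcases Nat.eq_zero_or_pos r with rfl | hr
  · simp [fourierTerm, fourierBound, show k - 1 ≠ 0 by omega]
  have hr1 : (1 : ℝ) ≤ r := by exact_mod_cast hr
  have hexp : ‖cexp (2 * Real.pi * I * ((a + 1 : ℕ) * z / M)) ^ r‖ ≤
      Real.exp (-(2 * Real.pi * y / M)) ^ a * Real.exp (-(2 * Real.pi * y / M)) ^ r *
        Real.exp (-(2 * Real.pi * (z.im - y) / M)) := by
    rw [norm_pow, Complex.norm_exp, ← Real.exp_nat_mul, ← Real.exp_nat_mul, ← Real.exp_nat_mul,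
      ← Real.exp_add, ← Real.exp_add, Real.exp_le_exp]
    have him : (2 * Real.pi * I * ((a + 1 : ℕ) * z / M) : ℂ).re =
        -(2 * Real.pi * ((a + 1) * z.im) / M) := by
      rw [show (2 * Real.pi * I * ((a + 1 : ℕ) * z / M) : ℂ) =
        ((2 * Real.pi * (a + 1) / M : ℝ) : ℂ) * (I * z) by push_cast; ring, re_ofReal_mul]
      simp
      ring
    rw [him]
    -- As `r ≥ 1`, the exponent satisfies `r (a + 1) ≥ a + r`.
    have h1 : 0 ≤ (a : ℝ) * (r - 1) := mul_nonneg (Nat.cast_nonneg a) (by linarith)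
    have h2 : (a : ℝ) * y + r * y + (z.im - y) ≤ r * ((a + 1) * z.im) := by
      nlinarith [mul_nonneg h1 hy.le, mul_nonneg (Nat.cast_nonneg (α := ℝ) a)
        (mul_nonneg (Nat.cast_nonneg (α := ℝ) r) (sub_nonneg.mpr hz)),
        mul_nonneg (sub_nonneg.mpr hr1) (sub_nonneg.mpr hz)]
    have h3 : 0 < 2 * Real.pi / M := by positivity
    calc _ = -(2 * Real.pi / M * (r * ((a + 1) * z.im))) := by ring
      _ ≤ -(2 * Real.pi / M * ((a : ℝ) * y + r * y + (z.im - y))) := by gcongr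
      _ = _ := by ring
  simp only [fourierTerm, fourierBound, norm_mul, norm_natCast, norm_pow (r : ℂ)]
  calc _ ≤ 1 * ((r : ℝ) ^ (k - 1) * (M * (Real.exp (-(2 * Real.pi * y / M)) ^ a *
        Real.exp (-(2 * Real.pi * y / M)) ^ r * Real.exp (-(2 * Real.pi * (z.im - y) / M))))) := by
        gcongr
        · exact χ.norm_le_one _
        · exact norm_charDFT_le ψ r
    _ = _ := by ring

lemma summable_fourierTerm {k : ℕ} (hk : 2 ≤ k) {L M : ℕ} [NeZero M] (χ : DirichletCharacter ℂ L)
    (ψ : DirichletCharacter ℂ M) {z : ℂ} (hz : 0 < z.im) : Summable (fourierTerm k χ ψ z) :=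
  Summable.of_norm_bounded ((summable_fourierBound k hz).mul_right _)
    (norm_fourierTerm_le hk χ ψ hz le_rfl)

/-- The constant factor in the Fourier expansion of `E_k(z; χ, ψ)`. -/
def fourierConst (k M : ℕ) : ℂ := 2 * ((-2 * Real.pi * I) ^ k / (k - 1).factorial / M ^ k)

/-- The Fourier expansion of the Eisenstein series. By the parity condition the pairs `(a, b)` and
`(-a, -b)` contribute equally. -/
lemma eisensteinChar_eq_fourier {k : ℕ} (hk : 3 ≤ k) {L M : ℕ} [NeZero M]
    (χ : DirichletCharacter ℂ L) (ψ : DirichletCharacter ℂ M)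
    (hpar : χ (-1) * ψ (-1) = (-1) ^ k) (z : ℍ) :
    eisensteinChar k χ ψ z =
      eisensteinConst k χ ψ + fourierConst k M * ∑' p, fourierTerm k χ ψ z p := by
  have hs := summable_eisensteinTerm hk χ ψ z
  set g : ℤ → ℂ := fun a ↦ χ (a : ZMod L) * ∑' b : ℤ, ψ (b : ZMod M) / ((a : ℂ) * z + b) ^ k with hg
  have hterm : ∀ a : ℤ, ∑' b : ℤ, eisensteinTerm k χ ψ z (a, b) = g a := by
    intro a
    simp only [hg]
    rw [← tsum_mul_left]
    refine tsum_congr fun b ↦ ?_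
    rw [eisensteinTerm]
    split_ifs with h
    · obtain ⟨rfl, rfl⟩ := Prod.mk.inj h
      simp [show k ≠ 0 by omega]
    · rw [mul_div_assoc]
  have hgs : Summable g := by
    have := hs.prod
    simpa only [hterm] using this
  have hev : ∀ a, g (-a) = g a := by
    intro a
    simp only [hg]
    rw [← (Equiv.neg ℤ).tsum_eq]
    have h1 : ∀ b : ℤ, ψ (((Equiv.neg ℤ) b : ℤ) : ZMod M) /
        (((-a : ℤ) : ℂ) * z + ((Equiv.neg ℤ) b : ℤ)) ^ k =
        ψ (-1) * (-1) ^ k * (ψ (b : ZMod M) / ((a : ℂ) * z + b) ^ k) := by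
      intro b
      rw [Equiv.neg_apply, Int.cast_neg, Int.cast_neg, Int.cast_neg,
        neg_eq_neg_one_mul (b : ZMod M), map_mul,
        show -(a : ℂ) * z + -(b : ℂ) = -((a : ℂ) * z + b) by ring, neg_pow ((a : ℂ) * z + b)]
      rcases neg_one_pow_eq_or ℂ k with h | h <;> rw [h] <;> field_simp
    simp_rw [h1]
    rw [tsum_mul_left, Int.cast_neg, neg_eq_neg_one_mul (a : ZMod L), map_mul]
    have h2 : χ (-1) * ψ (-1) * (-1) ^ k = 1 := by rw [hpar, ← mul_pow]; simp
    linear_combination (χ (a : ZMod L) * ∑' b : ℤ, ψ (b : ZMod M) / ((a : ℂ) * z + b) ^ k) * h2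
  rw [eisensteinChar, hs.tsum_prod]
  simp_rw [hterm]
  rw [tsum_int_eq_zero_add_two_mul_tsum_pnat hev hgs,
    tsum_pnat_eq_tsum_succ (f := fun n : ℕ ↦ g n)]
  congr 1
  · simp [hg, eisensteinConst]
  · have hfs := summable_fourierTerm (by omega : 2 ≤ k) χ ψ z.im_pos
    rw [hfs.tsum_prod, fourierConst, mul_assoc, nsmul_eq_mul, Nat.cast_ofNat]
    congr 1
    rw [← tsum_mul_left]
    refine tsum_congr fun a ↦ ?_
    have him : 0 < (((a + 1 : ℕ) : ℂ) * (z : ℂ)).im := by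
      rw [show ((a + 1 : ℕ) : ℂ) = ((a + 1 : ℝ) : ℂ) by push_cast; ring, im_ofReal_mul]
      exact mul_pos (by positivity) z.im_pos
    have h3 := tsum_char_div_pow ψ him (by omega : 2 ≤ k)
    simp only [hg, fourierTerm]
    rw [tsum_mul_left, mul_left_comm, ← h3]
    push_cast
    rfl

/-! ### The Eichler integral -/

lemma norm_tsum_fourierTerm_le {k : ℕ} (hk : 2 ≤ k) {L M : ℕ} [NeZero M]
    (χ : DirichletCharacter ℂ L) (ψ : DirichletCharacter ℂ M) {z : ℂ} {y : ℝ} (hy : 0 < y)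
    (hz : y ≤ z.im) :
    ‖∑' p, fourierTerm k χ ψ z p‖ ≤
      (∑' p, fourierBound k M y p) * Real.exp (-(2 * Real.pi * (z.im - y) / M)) :=
  tsum_of_norm_bounded ((summable_fourierBound k hy).hasSum.mul_right _)
    (norm_fourierTerm_le hk χ ψ hy hz)

lemma tendsto_eisensteinChar {k : ℕ} (hk : 3 ≤ k) {L M : ℕ} [NeZero M]
    (χ : DirichletCharacter ℂ L) (ψ : DirichletCharacter ℂ M)
    (hpar : χ (-1) * ψ (-1) = (-1) ^ k) :
    Tendsto (eisensteinChar k χ ψ) atImInfty (𝓝 (eisensteinConst k χ ψ)) := by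
  have hM : (0 : ℝ) < M := Nat.cast_pos.mpr (NeZero.pos M)
  have him : Tendsto UpperHalfPlane.im atImInfty atTop := tendsto_comap
  have h0 : Tendsto (fun z : ℍ ↦ ∑' p, fourierTerm k χ ψ z p) atImInfty (𝓝 0) := by
    refine squeeze_zero_norm' (a := fun z : ℍ ↦ (∑' p, fourierBound k M 1 p) *
      Real.exp (-(2 * Real.pi * (z.im - 1) / M))) ?_ ?_
    · filter_upwards [him.eventually_ge_atTop 1] with z hz
      exact norm_tsum_fourierTerm_le (by omega) χ ψ one_pos hz
    · rw [← mul_zero (∑' p, fourierBound k M 1 p)]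
      refine Tendsto.const_mul _ (Real.tendsto_exp_neg_atTop_nhds_zero.comp ?_)
      exact ((tendsto_atTop_add_const_right _ (-1) him).const_mul_atTop
        (by positivity)).atTop_div_const hM
  have h1 := (h0.const_mul (fourierConst k M)).const_add (eisensteinConst k χ ψ)
  rw [mul_zero, add_zero] at h1
  exact h1.congr fun z ↦ (eisensteinChar_eq_fourier hk χ ψ hpar z).symm

lemma fourierTerm_add_mul_I (k : ℕ) {L M : ℕ} (χ : DirichletCharacter ℂ L)
    (ψ : DirichletCharacter ℂ M) (z : ℂ) (t : ℝ) (p : ℕ × ℕ) :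
    fourierTerm k χ ψ (z + t * I) p = fourierTerm k χ ψ z p *
      (Real.exp (-(2 * Real.pi * (p.1 + 1) * p.2 / M * t)) : ℝ) := by
  simp only [fourierTerm]
  have : cexp (2 * Real.pi * I * ((p.1 + 1 : ℕ) * (z + t * I) / M)) ^ p.2 =
      cexp (2 * Real.pi * I * ((p.1 + 1 : ℕ) * z / M)) ^ p.2 *
      (Real.exp (-(2 * Real.pi * (p.1 + 1) * p.2 / M * t)) : ℝ) := by
    rw [ofReal_exp, ← Complex.exp_nat_mul, ← Complex.exp_nat_mul, ← Complex.exp_add]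
    congr 1
    push_cast
    linear_combination (2 * Real.pi * p.2 * (p.1 + 1) * t / M : ℂ) * I_sq
  rw [this]
  ring

lemma integral_pow_mul_exp_neg_mul (m : ℕ) {β : ℝ} (hβ : 0 < β) :
    ∫ t in Set.Ioi (0 : ℝ), t ^ m * Real.exp (-(β * t)) = m.factorial / β ^ (m + 1) := by
  have h := Real.integral_rpow_mul_exp_neg_mul_Ioi (a := m + 1) (by positivity) hβ
  rw [Real.Gamma_nat_eq_factorial, add_sub_cancel_right, ← Nat.cast_succ, Real.rpow_natCast,
    div_pow, one_pow, one_div_mul_eq_div] at h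
  simpa only [Real.rpow_natCast] using h

lemma integrableOn_pow_mul_exp_neg_mul (m : ℕ) {β : ℝ} (hβ : 0 < β) :
    IntegrableOn (fun t : ℝ ↦ t ^ m * Real.exp (-(β * t))) (Set.Ioi 0) := by
  refine Integrable.of_integral_ne_zero ?_
  rw [integral_pow_mul_exp_neg_mul m hβ]
  positivity

/-- The Fourier expansion may be integrated term by term. -/
lemma eichler_fourier {k : ℕ} (hk : 3 ≤ k) {L M : ℕ} [NeZero M]
    (χ : DirichletCharacter ℂ L) (ψ : DirichletCharacter ℂ M)
    (hpar : χ (-1) * ψ (-1) = (-1) ^ k) (τ : ℍ) :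
    IntegrableOn (eichlerIntegrand k (eisensteinChar k χ ψ) τ) (Set.Ioi 0) ∧
    HasSum (fun p : ℕ × ℕ ↦ ∫ t in Set.Ioi (0 : ℝ),
      fourierConst k M * fourierTerm k χ ψ (τ + t * I) p * (t * I) ^ (k - 2) * I)
      (eichlerEisenstein k χ ψ τ) := by
  have hM : (0 : ℝ) < M := Nat.cast_pos.mpr (NeZero.pos M)
  have hy : 0 < (τ : ℂ).im := τ.im_pos
  set F : ℕ × ℕ → ℝ → ℂ := fun p t ↦
    fourierConst k M * fourierTerm k χ ψ (τ + t * I) p * (t * I) ^ (k - 2) * I with hF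
  set h : ℝ → ℝ := fun t ↦ t ^ (k - 2) * Real.exp (-(2 * Real.pi / M * t)) with hh
  have hhi : IntegrableOn h (Set.Ioi 0) := integrableOn_pow_mul_exp_neg_mul _ (by positivity)
  set b : ℕ × ℕ → ℝ := fun p ↦ ‖fourierConst k M‖ * fourierBound k M (τ : ℂ).im p with hb
  have hbs : Summable b := (summable_fourierBound k hy).mul_left _
  have hFm : ∀ p, AEStronglyMeasurable (F p) (volume.restrict (Set.Ioi 0)) := by
    intro p
    refine Continuous.aestronglyMeasurable ?_
    simp only [hF, fourierTerm]
    fun_prop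
  have hFb : ∀ p, ∀ t ∈ Set.Ioi (0 : ℝ), ‖F p t‖ ≤ b p * h t := by
    intro p t ht
    have ht0 : (0 : ℝ) < t := ht
    have h1 := norm_fourierTerm_le (by omega : 2 ≤ k) χ ψ hy (z := τ + t * I) (by simp [ht0.le]) p
    have h2 : ((τ : ℂ) + t * I).im - (τ : ℂ).im = t := by simp
    rw [h2] at h1
    simp only [hF, norm_mul, norm_pow, norm_real, norm_I, mul_one, Real.norm_of_nonneg ht0.le]
    calc _ ≤ ‖fourierConst k M‖ * (fourierBound k M (τ : ℂ).im p *
          Real.exp (-(2 * Real.pi * t / M))) * t ^ (k - 2) := by gcongr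
      _ = _ := by
          simp only [hb, hh]
          rw [show 2 * Real.pi * t / M = 2 * Real.pi / M * t by ring]
          ring
  have hlim : ∀ t ∈ Set.Ioi (0 : ℝ), HasSum (fun p ↦ F p t)
      (eichlerIntegrand k (eisensteinChar k χ ψ) τ t) := by
    intro t ht
    have ht0 : (0 : ℝ) < t := ht
    have him : 0 < ((τ : ℂ) + t * I).im := by simpa using add_pos hy ht0
    have hs := (summable_fourierTerm (by omega : 2 ≤ k) χ ψ him).hasSum
    have hv : valueAtInfty (eisensteinChar k χ ψ) = eisensteinConst k χ ψ :=
      (tendsto_eisensteinChar hk χ ψ hpar).limUnder_eq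
    rw [eichlerIntegrand, hv, ofComplex_apply_of_im_pos him, eisensteinChar_eq_fourier hk χ ψ hpar,
      add_sub_cancel_left, show (k : ℤ) - 2 = (k - 2 : ℕ) by omega, zpow_natCast]
    exact ((hs.mul_left _).mul_right _).mul_right _
  have hbi : IntegrableOn (fun t ↦ ∑' p, b p * h t) (Set.Ioi 0) := by
    simp_rw [tsum_mul_right]
    exact hhi.const_mul _
  refine ⟨?_, ?_⟩
  · refine Integrable.mono' hbi ?_ ?_
    · refine aestronglyMeasurable_of_tendsto_ae (u := (atTop : Filter (Finset (ℕ × ℕ))))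
        (f := fun s t ↦ ∑ p ∈ s, F p t) (fun s ↦ ?_) ?_
      · exact Finset.aestronglyMeasurable_fun_sum s fun p _ ↦ hFm p
      · exact (ae_restrict_iff' measurableSet_Ioi).mpr (Eventually.of_forall hlim)
    · refine (ae_restrict_iff' measurableSet_Ioi).mpr (Eventually.of_forall fun t ht ↦ ?_)
      rw [← (hlim t ht).tsum_eq]
      exact tsum_of_norm_bounded (hbs.mul_right _).hasSum fun p ↦ hFb p t ht
  · exact hasSum_integral_of_dominated_convergence (fun p t ↦ b p * h t) hFm
      (fun p ↦ (ae_restrict_iff' measurableSet_Ioi).mpr (Eventually.of_forall (hFb p)))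
      (Eventually.of_forall fun t ↦ hbs.mul_right _) hbi
      ((ae_restrict_iff' measurableSet_Ioi).mpr (Eventually.of_forall hlim))

/-- Integrating a Fourier term divides its coefficient by `((a + 1) r) ^ (k - 1)` and produces a
term of the Fourier expansion of the cotangent sum. For `r = 0` both sides vanish. -/
lemma integral_fourierTerm {k : ℕ} (hk : 3 ≤ k) {L M : ℕ} [NeZero M]
    (χ : DirichletCharacter ℂ L) {ψ : DirichletCharacter ℂ M} (hψ : ψ ≠ 1) (z : ℂ) (a r : ℕ) :
    ∫ t in Set.Ioi (0 : ℝ),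
      fourierConst k M * fourierTerm k χ ψ (z + t * I) (a, r) * (t * I) ^ (k - 2) * I =
    2 / ((k : ℂ) - 1) * (χ ((a + 1 : ℕ) : ZMod L) / ((a + 1 : ℕ) : ℂ) ^ (k - 1) *
      (-(2 * Real.pi * I) / M * (charDFT ψ r *
        cexp (2 * Real.pi * I * (((a + 1 : ℕ) * z) / M)) ^ r))) := by
  obtain ⟨m, rfl⟩ : ∃ m, k = m + 2 := ⟨k - 2, by omega⟩
  rcases Nat.eq_zero_or_pos r with rfl | hr
  · simp [fourierTerm, charDFT_zero hψ]
  have hM : (0 : ℝ) < M := Nat.cast_pos.mpr (NeZero.pos M)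
  have hM' : (M : ℂ) ≠ 0 := NeZero.ne _
  have hr0 : (0 : ℝ) < r := Nat.cast_pos.mpr hr
  have hr' : (r : ℂ) ≠ 0 := by exact_mod_cast hr.ne'
  set β : ℝ := 2 * Real.pi * (a + 1) * r / M with hβ
  have hβ0 : 0 < β := by positivity
  have e : ∀ t : ℝ, fourierConst (m + 2) M * fourierTerm (m + 2) χ ψ (z + t * I) (a, r) *
      (t * I) ^ (m + 2 - 2) * I = fourierConst (m + 2) M * fourierTerm (m + 2) χ ψ z (a, r) *
      I ^ (m + 1) * ((t ^ m * Real.exp (-(β * t)) : ℝ) : ℂ) := by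
    intro t
    rw [fourierTerm_add_mul_I, Nat.add_sub_cancel, hβ]
    push_cast
    ring
  simp_rw [e]
  rw [integral_const_mul, integral_complex_ofReal, integral_pow_mul_exp_neg_mul m hβ0]
  simp only [fourierConst, fourierTerm]
  rw [show m + 2 - 1 = m + 1 by omega, Nat.factorial_succ, hβ]
  have hI : (-2 * Real.pi * I : ℂ) ^ (m + 2) * I ^ (m + 1) =
      (2 * Real.pi) ^ (m + 1) * (-(2 * Real.pi * I)) := by
    rw [pow_succ (-2 * Real.pi * I : ℂ) (m + 1), mul_right_comm, ← mul_pow,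
      show (-2 * Real.pi * I * I : ℂ) = 2 * Real.pi by linear_combination (-2 * Real.pi : ℂ) * I_sq]
    ring
  have hm : (m : ℂ) + 1 ≠ 0 := by exact_mod_cast Nat.succ_ne_zero m
  have ha : (a : ℂ) + 1 ≠ 0 := by exact_mod_cast Nat.succ_ne_zero a
  have hf : (m.factorial : ℂ) ≠ 0 := by exact_mod_cast m.factorial_ne_zero
  have hpi : (Real.pi : ℂ) ≠ 0 := ofReal_ne_zero.mpr Real.pi_ne_zero
  push_cast
  rw [show (m : ℂ) + 2 - 1 = m + 1 by ring]
  generalize cexp (2 * Real.pi * I * ((a + 1) * z / M)) ^ r = x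
  calc _ = 2 / ((m + 1) * m.factorial) / M ^ (m + 2) * (χ (a + 1) * (r ^ (m + 1) *
        (charDFT ψ r * x))) * ((-2 * Real.pi * I : ℂ) ^ (m + 2) * I ^ (m + 1)) *
        (m.factorial / (2 * Real.pi * (a + 1) * r / M) ^ (m + 1)) := by ring
    _ = _ := by
        rw [hI, div_pow, mul_pow _ (r : ℂ), mul_pow _ ((a : ℂ) + 1)]
        field_simp
        ring

/-- The Eichler integral as a series of cotangent sums. -/
lemma hasSum_eichlerEisenstein {k : ℕ} (hk : 3 ≤ k) {L M : ℕ} [NeZero M]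
    (χ : DirichletCharacter ℂ L) {ψ : DirichletCharacter ℂ M} (hψ : ψ ≠ 1)
    (hpar : χ (-1) * ψ (-1) = (-1) ^ k) (τ : ℍ) :
    HasSum (fun a : ℕ ↦ 2 / ((k : ℂ) - 1) * (χ ((a + 1 : ℕ) : ZMod L) /
      ((a + 1 : ℕ) : ℂ) ^ (k - 1) * charCot ψ ((a + 1 : ℕ) * τ))) (eichlerEisenstein k χ ψ τ) := by
  have h := (eichler_fourier hk χ ψ hpar τ).2
  refine h.prod_fiberwise fun a ↦ ?_
  simp_rw [integral_fourierTerm hk χ hψ]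
  refine HasSum.mul_left _ (HasSum.mul_left _ (hasSum_charCot hψ ?_))
  rw [← ofReal_natCast, im_ofReal_mul]
  exact mul_pos (by positivity) τ.im_pos

lemma charCot_neg {N : ℕ} [NeZero N] (χ : DirichletCharacter ℂ N) {w : ℂ} (hw : w.im ≠ 0) :
    charCot χ (-w) = -χ (-1) * charCot χ w := by
  have hu : Tendsto (fun n : ℕ ↦ n * N) atTop atTop :=
    tendsto_id.atTop_mul_const' (NeZero.pos N)
  have hd : ∀ n : ℕ, N ∣ n * N := fun n ↦ Dvd.intro_left n rfl
  refine tendsto_nhds_unique (tendsto_sum_Icc_charCot χ (w := -w) (by simpa using hw) hu hd) ?_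
  refine ((tendsto_sum_Icc_charCot χ hw hu hd).const_mul (-χ (-1))).congr fun n ↦ ?_
  rw [Finset.mul_sum]
  refine Finset.sum_nbij' (fun a ↦ -a) (fun a ↦ -a) ?_ ?_ ?_ ?_ ?_
  · intro a; simp only [Finset.mem_Icc]; omega
  · intro a; simp only [Finset.mem_Icc]; omega
  · simp
  · simp
  · intro a _
    rw [Int.cast_neg, Int.cast_neg, neg_eq_neg_one_mul (a : ZMod N), map_mul, ← neg_add, div_neg]
    ring

/-- The Eichler integral is a cotangent series over all integers; by parity the terms `a` and `-a`
are equal. -/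
lemma eichlerEisenstein_eq_cotSeries {k : ℕ} (hk : 3 ≤ k) {L M : ℕ} [NeZero M]
    (χ : DirichletCharacter ℂ L) {ψ : DirichletCharacter ℂ M} (hψ : ψ ≠ 1)
    (hpar : χ (-1) * ψ (-1) = (-1) ^ k) (τ : ℍ) :
    eichlerEisenstein k χ ψ τ = 1 / ((k : ℂ) - 1) * cotSeries k χ ψ τ := by
  obtain ⟨m, rfl⟩ : ∃ m, k = m + 1 := ⟨k - 1, by omega⟩
  have hm : (m : ℂ) ≠ 0 := by exact_mod_cast (by omega : m ≠ 0)
  have hk1 : ((m + 1 : ℕ) : ℂ) - 1 = m := by push_cast; ring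
  set g : ℤ → ℂ := fun a ↦ χ (a : ZMod L) / (a : ℂ) ^ (m + 1 - 1) * charCot ψ (a * τ) with hg
  have h := (hasSum_eichlerEisenstein hk χ hψ hpar τ).mul_left ((m : ℂ) / 2)
  rw [hk1] at h
  have h1 : HasSum (fun a : ℕ ↦ g ((a + 1 : ℕ) : ℤ))
      ((m : ℂ) / 2 * eichlerEisenstein (m + 1) χ ψ τ) := by
    refine h.congr_fun fun a ↦ ?_
    simp only [hg]
    push_cast
    field_simp
  have hneg : ∀ a : ℕ, g (-((a : ℤ) + 1)) = g ((a + 1 : ℕ) : ℤ) := by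
    intro a
    have hw : (((a : ℂ) + 1) * τ).im ≠ 0 := by
      rw [show (a : ℂ) + 1 = ((a + 1 : ℝ) : ℂ) by push_cast; ring, im_ofReal_mul]
      exact (mul_pos (by positivity) τ.im_pos).ne'
    simp only [hg]
    push_cast
    rw [neg_eq_neg_one_mul ((a : ZMod L) + 1), map_mul, neg_mul, charCot_neg ψ hw,
      neg_pow ((a : ℂ) + 1)]
    rw [pow_succ] at hpar
    have h2 : χ (-1) * ψ (-1) * (-1) ^ m = -1 := by
      rw [hpar, mul_right_comm, ← mul_pow]
      simp
    rcases neg_one_pow_eq_or ℂ m with h3 | h3 <;> rw [h3] at h2 ⊢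
    · linear_combination (-(χ (a + 1) / (a + 1 : ℂ) ^ m * charCot ψ ((a + 1) * τ))) * h2
    · rw [neg_one_mul, div_neg]
      linear_combination (-(χ (a + 1) / (a + 1 : ℂ) ^ m * charCot ψ ((a + 1) * τ))) * h2
  have h0 : g ((0 : ℕ) : ℤ) = 0 := by
    have : ((0 : ℕ) : ℂ) ^ (m + 1 - 1) = 0 := by simp; omega
    simp only [hg, Int.cast_natCast, this]
    simp
  have h2 : HasSum (fun a : ℕ ↦ g (a : ℤ)) ((m : ℂ) / 2 * eichlerEisenstein (m + 1) χ ψ τ) := by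
    refine (hasSum_nat_add_iff' 1).mp ?_
    rw [Finset.sum_range_one, h0, sub_zero]
    exact h1
  have h3 : HasSum (fun a : ℕ ↦ g (-((a : ℤ) + 1)))
      ((m : ℂ) / 2 * eichlerEisenstein (m + 1) χ ψ τ) := by
    simp_rw [hneg]
    exact h1
  have h4 := (h2.of_nat_of_neg_add_one h3).tsum_eq
  rw [cotSeries, h4, hk1]
  field_simp
  ring

/-- The functional equation of the Eichler integral under powers of `R`. -/
lemma eichlerEisenstein_sub_slash {k : ℕ} (hk : 3 ≤ k) {L M : ℕ} [NeZero L] [NeZero M]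
    {χ : DirichletCharacter ℂ L} {ψ : DirichletCharacter ℂ M} (hχ : χ.IsPrimitive)
    (hψ : ψ.IsPrimitive) (hpar : χ (-1) * ψ (-1) = (-1) ^ k) (hψ1 : ψ ≠ 1)
    {n : ℤ} (hn : (L : ℤ) ∣ n) (τ : ℍ) :
    (eichlerEisenstein k χ ψ - eichlerEisenstein k χ ψ ∣[(2 : ℤ) - (k : ℤ)] (matR ^ n)) τ =
      -(4 * ψ (-1) / ((k : ℂ) - 1)) *
        ∑ s ∈ Finset.range (k + 1) with χ (-1) = (-1) ^ s,
          χ.LFunction (s : ℂ) * ψ.LFunction ((k : ℂ) - (s : ℂ)) *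
            (τ : ℂ) ^ ((k : ℤ) - (s : ℤ) - 1) *
            (1 - ((n : ℂ) * (τ : ℂ) + 1) ^ ((s : ℤ) - 1)) := by
  have hR : ∀ n : ℤ, (matR ^ n).1 = !![1, 0; n, 1] := by
    have hnat : ∀ n : ℕ, (matR ^ n).1 = !![1, 0; (n : ℤ), 1] := by
      intro n
      induction n with
      | zero => ext i j; fin_cases i <;> fin_cases j <;> simp
      | succ n ih =>
        rw [pow_succ, Matrix.SpecialLinearGroup.coe_mul, ih]
        simp [matR]
    intro n
    obtain ⟨m, rfl | rfl⟩ := n.eq_nat_or_neg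
    · rw [zpow_natCast, hnat]
    · rw [zpow_neg, zpow_natCast, Matrix.SpecialLinearGroup.coe_inv, hnat,
        Matrix.adjugate_fin_two_of]
      simp
  have h10 : (matR ^ n) 1 0 = n := by
    show (matR ^ n).1 1 0 = n
    simp [hR]
  have h11 : (matR ^ n) 1 1 = 1 := by
    show (matR ^ n).1 1 1 = 1
    simp [hR]
  have h00 : (matR ^ n) 0 0 = 1 := by
    show (matR ^ n).1 0 0 = 1
    simp [hR]
  have h01 : (matR ^ n) 0 1 = 0 := by
    show (matR ^ n).1 0 1 = 0
    simp [hR]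
  have hden : denom (matR ^ n : SL(2, ℤ)) τ = n * τ + 1 := by
    rw [ModularGroup.denom_apply, h10, h11]
    simp
  have hsm : (((matR ^ n : SL(2, ℤ)) • τ : ℍ) : ℂ) = τ / (n * τ + 1) := by
    rw [UpperHalfPlane.specialLinearGroup_apply]
    simp [h00, h01, h10, h11]
  have hslash := cotSeries_sub_slash hk hχ hψ hpar hψ1 (τ := τ) τ.im_pos.ne' hn
  rw [Pi.sub_apply, ModularForm.SL_slash_apply, eichlerEisenstein_eq_cotSeries hk χ hψ1 hpar,
    eichlerEisenstein_eq_cotSeries hk χ hψ1 hpar, hden, hsm,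
    show -((2 : ℤ) - k) = (k - 2 : ℕ) by omega, zpow_natCast, mul_right_comm, mul_assoc,
    ← mul_sub, hslash]
  ring

/-! ### The secant Dirichlet series -/

lemma chiNegFour_natCast (n : ℕ) : chiNegFour (n : ZMod 4) = ((ZMod.χ₄ n : ℤ) : ℂ) := rfl

lemma chiNegFour_neg_one : chiNegFour (-1) = -1 := by
  have h : ZMod.χ₄ (-1) = -1 := by decide
  rw [chiNegFour, MulChar.ringHomComp_apply, h]
  simp

lemma chiNegFour_ne_one : chiNegFour ≠ 1 := by
  intro h
  have h1 := chiNegFour_neg_one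
  rw [h, MulChar.one_apply isUnit_one.neg] at h1
  norm_num at h1

/-- `χ₋₄` does not factor through a proper divisor of `4`, as `-1 = 1` modulo `2`. -/
lemma isPrimitive_chiNegFour : chiNegFour.IsPrimitive := by
  rw [DirichletCharacter.isPrimitive_def]
  have hd := chiNegFour.conductor_dvd_level
  have hle := Nat.le_of_dvd (by norm_num) hd
  by_contra hne
  have h2 : chiNegFour.conductor ∣ 2 := by
    generalize chiNegFour.conductor = c at hd hle hne
    interval_cases c <;> simp_all
  obtain ⟨h, χ₀, hχ₀⟩ := chiNegFour.factorsThrough_conductor.mono chiNegFour h2 (by norm_num)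
  have h3 := DirichletCharacter.changeLevel_eq_cast_of_dvd χ₀ h (-1)
  rw [← hχ₀] at h3
  push_cast at h3
  rw [chiNegFour_neg_one, ZMod.cast_neg h, ZMod.cast_one h, show (-1 : ZMod 2) = 1 by decide,
    map_one] at h3
  norm_num at h3

/-- The cotangent sum of `χ₋₄` is a secant. At the poles both sides are `0` by the convention on
division. -/
lemma charCot_chiNegFour (w : ℂ) :
    charCot chiNegFour w = Real.pi / 2 * (Complex.cos (Real.pi * (w / 2)))⁻¹ := by
  have h0 : chiNegFour ((0 : ℕ) : ZMod 4) = 0 := by rw [chiNegFour_natCast]; simp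
  have h1 : chiNegFour ((1 : ℕ) : ZMod 4) = 1 := by simp
  have h2 : chiNegFour ((2 : ℕ) : ZMod 4) = 0 := by
    rw [chiNegFour_natCast, show ZMod.χ₄ ((2 : ℕ) : ZMod 4) = 0 by decide]; simp
  have h3 : chiNegFour ((3 : ℕ) : ZMod 4) = -1 := by
    rw [chiNegFour_natCast, show ZMod.χ₄ ((3 : ℕ) : ZMod 4) = -1 by decide]; simp
  simp only [charCot, Finset.sum_range_succ, Finset.sum_range_zero, h0, h1, h2, h3]
  push_cast
  set y : ℂ := Real.pi * ((w + 1) / 4) with hy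
  have e3 : Real.pi * ((w + 3) / 4) = y + Real.pi / 2 := by rw [hy]; ring
  have ec : Real.pi * (w / 2) = 2 * y - Real.pi / 2 := by rw [hy]; ring
  rw [e3, ec, Complex.cos_sub_pi_div_two, Complex.sin_two_mul]
  simp only [Complex.cot]
  rw [Complex.sin_add_pi_div_two, Complex.cos_add_pi_div_two]
  by_cases hs : Complex.sin y = 0
  · simp [hs]
  by_cases hc : Complex.cos y = 0
  · simp [hc]
  have := Complex.sin_sq_add_cos_sq y
  field_simp
  linear_combination (4 * Real.pi : ℂ) * this

lemma hasSum_secantTerm {m : ℕ} (hm : 0 < m) (τ : ℍ) :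
    HasSum (secantTerm (2 * m) ((τ : ℂ) / 2)) (2 * (m : ℂ) / (Real.pi : ℂ) *
      eichlerEisenstein (2 * m + 1) (1 : DirichletCharacter ℂ 1) chiNegFour τ) := by
  have hpar : (1 : DirichletCharacter ℂ 1) (-1) * chiNegFour (-1) = (-1) ^ (2 * m + 1) := by
    rw [chiNegFour_neg_one, MulChar.one_apply isUnit_one.neg]
    simp [pow_succ, pow_mul]
  have h := (hasSum_eichlerEisenstein (by omega : 3 ≤ 2 * m + 1) (1 : DirichletCharacter ℂ 1)
    chiNegFour_ne_one hpar τ).mul_left (2 * (m : ℂ) / (Real.pi : ℂ))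
  refine h.congr_fun fun a ↦ ?_
  have hm' : (m : ℂ) ≠ 0 := by exact_mod_cast hm.ne'
  have hpi : (Real.pi : ℂ) ≠ 0 := ofReal_ne_zero.mpr Real.pi_ne_zero
  have h1 : (1 : DirichletCharacter ℂ 1) ((a + 1 : ℕ) : ZMod 1) = 1 := by
    rw [Subsingleton.elim ((a + 1 : ℕ) : ZMod 1) 1, map_one]
  rw [secantTerm, charCot_chiNegFour, h1, Nat.add_sub_cancel,
    show ((2 * m + 1 : ℕ) : ℂ) - 1 = 2 * m by push_cast; ring]
  push_cast
  rw [show Real.pi * ((a + 1 : ℂ)) * (τ / 2) = Real.pi * ((a + 1) * τ / 2) by ring]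
  field_simp

lemma secantTerm_conj (s : ℕ) (τ : ℂ) (n : ℕ) :
    secantTerm s (starRingEnd ℂ τ) n = starRingEnd ℂ (secantTerm s τ n) := by
  rw [secantTerm, secantTerm, map_div₀, map_inv₀, ← Complex.cos_conj]
  simp

lemma secantSeries_conj (s : ℕ) (τ : ℂ) :
    secantSeries s (starRingEnd ℂ τ) = starRingEnd ℂ (secantSeries s τ) := by
  rw [secantSeries, secantSeries, Complex.conj_tsum]
  exact tsum_congr fun n ↦ secantTerm_conj s τ n

lemma summable_secantTerm {m : ℕ} (hm : 0 < m) {τ : ℂ} (hτ : τ.im ≠ 0) :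
    Summable (secantTerm (2 * m) τ) := by
  have hpos : ∀ z : ℂ, 0 < z.im → Summable (secantTerm (2 * m) z) := by
    intro z hz
    have := (hasSum_secantTerm hm ⟨2 * z, by simpa using hz⟩).summable
    rwa [UpperHalfPlane.coe_mk, mul_div_cancel_left₀ z two_ne_zero] at this
  rcases lt_or_gt_of_ne hτ with h | h
  · have h1 := hpos (starRingEnd ℂ τ) (by simpa using h)
    have h2 : Summable fun n ↦ starRingEnd ℂ (secantTerm (2 * m) (starRingEnd ℂ τ) n) :=
      h1.map (starRingEnd ℂ) Complex.continuous_conj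
    refine h2.congr fun n ↦ ?_
    rw [← secantTerm_conj, Complex.conj_conj]
  · exact hpos τ h

open PowerSeries in
/-- The values of the odd Bernoulli polynomials at `1 / 4` are Euler numbers: the generating
function of `B_n(1 / 4) - B_n(3 / 4)` is `-(t / 2) sech (t / 4)`. -/
lemma bernoulli_eval_one_quarter (j : ℕ) :
    (Polynomial.bernoulli (2 * j + 1)).eval (1 / 4 : ℚ) =
      -(2 * j + 1) * eulerNum (2 * j) / 4 ^ (2 * j + 1) := by
  set C : ℚ⟦X⟧ := PowerSeries.mk fun j : ℕ => if Even j then (j.factorial : ℚ)⁻¹ else 0 with hC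
  set e : ℚ⟦X⟧ := rescale (1 / 4 : ℚ) (exp ℚ) with he
  set e' : ℚ⟦X⟧ := rescale (-(1 / 4) : ℚ) (exp ℚ) with he'
  have hee' : e * e' = 1 := by
    rw [he, he', exp_mul_exp_eq_exp_add, add_neg_cancel, rescale_zero]
    simp
  have he2 : e ^ 2 = rescale (1 / 2 : ℚ) (exp ℚ) := by
    rw [pow_two, he, exp_mul_exp_eq_exp_add]
    norm_num
  have he3 : e ^ 3 = rescale (3 / 4 : ℚ) (exp ℚ) := by
    rw [pow_succ, he2, he, exp_mul_exp_eq_exp_add]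
    norm_num
  have he4 : e ^ 4 = exp ℚ := by
    rw [pow_succ, he3, he, exp_mul_exp_eq_exp_add]
    norm_num
  have hsum : e + e' = 2 * rescale (1 / 4 : ℚ) C := by
    ext n
    rw [show (2 : ℚ⟦X⟧) = PowerSeries.C (2 : ℚ) from (map_ofNat _ 2).symm, coeff_C_mul]
    simp only [he, he', hC, map_add, coeff_rescale, coeff_exp, coeff_mk, neg_pow (1 / 4 : ℚ)]
    rcases Nat.even_or_odd n with hn | hn
    · simp [hn]; ring
    · simp [hn, Nat.not_even_iff_odd.mpr hn]
  have hne : e ^ 2 - 1 ≠ 0 := by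
    intro h
    have := congrArg (coeff 1) h
    rw [he2] at this
    simp [coeff_rescale, coeff_exp, coeff_one] at this
  have hC0 : constantCoeff C ≠ 0 := by
    rw [← coeff_zero_eq_constantCoeff_apply]
    simp [hC]
  set D : ℚ⟦X⟧ := (mk fun n => Polynomial.aeval (1 / 4 : ℚ)
      ((1 / n.factorial : ℚ) • Polynomial.bernoulli n)) -
    (mk fun n => Polynomial.aeval (3 / 4 : ℚ)
      ((1 / n.factorial : ℚ) • Polynomial.bernoulli n)) with hD
  -- With `e = exp (t / 4)` this reads `D (e ^ 4 - 1) = t (e - e ^ 3)`; cancel `e ^ 2 - 1`.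
  have h1 : D * (e ^ 4 - 1) = X * (e - e ^ 3) := by
    rw [hD, he4, sub_mul, Polynomial.bernoulli_generating_function,
      Polynomial.bernoulli_generating_function, he3, he, mul_sub]
  have h2 : D * (e ^ 2 + 1) = -(X * e) := by
    refine mul_right_cancel₀ hne ?_
    linear_combination h1
  have h3 : 2 * D * rescale (1 / 4 : ℚ) C = -X := by
    linear_combination e' * h2 - D * hsum - D * e * hee' - (X : ℚ⟦X⟧) * hee'
  have h4 : 2 * D = -X * rescale (1 / 4 : ℚ) C⁻¹ := by
    have h5 : rescale (1 / 4 : ℚ) C * rescale (1 / 4 : ℚ) C⁻¹ = 1 := by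
      rw [← map_mul, PowerSeries.mul_inv_cancel C hC0, map_one]
    linear_combination (rescale (1 / 4 : ℚ) C⁻¹) * h3 - 2 * D * h5
  have h6 := congrArg (coeff (2 * j + 1)) h4
  rw [neg_mul, map_neg, coeff_succ_X_mul, coeff_rescale,
    show (2 : ℚ⟦X⟧) = PowerSeries.C (2 : ℚ) from (map_ofNat _ 2).symm, coeff_C_mul] at h6
  simp only [hD, map_sub, coeff_mk, map_smul, smul_eq_mul, Polynomial.coe_aeval_eq_eval] at h6
  have h7 := Polynomial.bernoulli_eval_one_sub (2 * j + 1) (1 / 4 : ℚ)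
  rw [show (1 : ℚ) - 1 / 4 = 3 / 4 by norm_num] at h7
  rw [h7, (odd_two_mul_add_one j).neg_one_pow, one_div, one_div, inv_pow] at h6
  rw [eulerNum, ← hC]
  have hf : ((2 * j).factorial : ℚ) ≠ 0 := by exact_mod_cast Nat.factorial_ne_zero _
  rw [Nat.factorial_succ] at h6
  rw [one_div, pow_succ]
  push_cast at h6
  field_simp at h6 ⊢
  linear_combination h6

lemma sin_two_pi_mul_quarter (n : ℕ) : Real.sin (2 * Real.pi * n * (1 / 4)) = (ZMod.χ₄ n : ℤ) := by
  obtain ⟨q, r, hr, rfl⟩ : ∃ q r, r < 4 ∧ n = 4 * q + r :=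
    ⟨n / 4, n % 4, Nat.mod_lt _ (by norm_num), (Nat.div_add_mod n 4).symm⟩
  have h1 : 2 * Real.pi * (4 * q + r : ℕ) * (1 / 4) = r * (Real.pi / 2) + q * (2 * Real.pi) := by
    push_cast; ring
  rw [h1, Real.sin_add_nat_mul_two_pi, ZMod.χ₄_nat_mod_four, Nat.mul_add_mod, Nat.mod_eq_of_lt hr]
  interval_cases r
  · simp
  · simp
  · rw [show ((2 : ℕ) : ℝ) * (Real.pi / 2) = Real.pi by push_cast; ring, Real.sin_pi,
      show ZMod.χ₄ ((2 : ℕ) : ZMod 4) = 0 by decide]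
    simp
  · rw [show ((3 : ℕ) : ℝ) * (Real.pi / 2) = Real.pi / 2 + Real.pi by push_cast; ring,
      Real.sin_add_pi, Real.sin_pi_div_two, show ZMod.χ₄ ((3 : ℕ) : ZMod 4) = -1 by decide]
    simp

lemma eulerNum_zero : eulerNum 0 = 1 := by
  have h := bernoulli_eval_one_quarter 0
  rw [mul_zero, zero_add, Polynomial.bernoulli_one] at h
  simp at h
  linarith

/-- The Leibniz series. -/
lemma LFunction_chiNegFour_one : chiNegFour.LFunction 1 = Real.pi / 4 := by
  have h1 := (tendsto_sum_char_div chiNegFour_ne_one).comp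
    (tendsto_id.const_mul_atTop' (show 0 < 2 by norm_num))
  have h2 := (continuous_ofReal.tendsto (Real.pi / 4)).comp Real.tendsto_sum_pi_div_four
  push_cast at h2
  refine tendsto_nhds_unique h1 (h2.congr fun n ↦ ?_)
  simp only [Function.comp_apply, id_eq]
  induction n with
  | zero => simp
  | succ n ih =>
    rw [Finset.sum_range_succ, ofReal_add, ih, show 2 * (n + 1) + 1 = 2 * n + 1 + 1 + 1 by ring,
      Finset.sum_range_succ _ (2 * n + 1 + 1), Finset.sum_range_succ _ (2 * n + 1), add_assoc]
    congr 1
    have e1 : ZMod.χ₄ ((2 * n + 1 : ℕ) : ZMod 4) = (-1) ^ n := by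
      rw [ZMod.χ₄_eq_neg_one_pow (by omega)]
      congr 1
      omega
    have e2 : ZMod.χ₄ ((2 * n + 1 + 1 : ℕ) : ZMod 4) = 0 := by
      rw [ZMod.χ₄_nat_eq_if_mod_four, if_pos (by omega)]
    rw [chiNegFour_natCast, chiNegFour_natCast, e1, e2]
    push_cast
    simp

/-- The values of `L(s, χ₋₄)` at the odd positive integers. -/
lemma LFunction_chiNegFour (j : ℕ) : chiNegFour.LFunction (2 * j + 1 : ℕ) =
    (-1) ^ j * (eulerNum (2 * j) : ℚ) * Real.pi ^ (2 * j + 1) /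
      (4 ^ (j + 1) * (2 * j).factorial) := by
  rcases eq_or_ne j 0 with rfl | hj
  · simp [LFunction_chiNegFour_one, eulerNum_zero]
  have hre : 1 < ((2 * j + 1 : ℕ) : ℂ).re := by
    rw [natCast_re]
    exact_mod_cast (by omega : 1 < 2 * j + 1)
  have h := hasSum_one_div_nat_pow_mul_sin hj (x := 1 / 4) (by constructor <;> norm_num)
  have hB : (Polynomial.map (algebraMap ℚ ℝ) (Polynomial.bernoulli (2 * j + 1))).eval (1 / 4 : ℝ) =
      ((-(2 * j + 1) * eulerNum (2 * j) / 4 ^ (2 * j + 1) : ℚ) : ℝ) := by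
    rw [← bernoulli_eval_one_quarter, show (1 / 4 : ℝ) = algebraMap ℚ ℝ (1 / 4) by simp,
      Polynomial.eval_map, Polynomial.eval₂_at_apply]
    simp
  rw [hB] at h
  have h' := Complex.hasSum_ofReal.mpr h
  rw [DirichletCharacter.LFunction_eq_LSeries _ hre]
  have h2 := (DirichletCharacter.LSeriesSummable_of_one_lt_re chiNegFour hre).hasSum
  have h3 : LSeries (fun n ↦ chiNegFour (n : ZMod 4)) (2 * j + 1 : ℕ) = _ :=
    h2.unique (h'.congr_fun fun n ↦ ?_)
  · rw [h3, Nat.factorial_succ]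
    have hf : ((2 * j).factorial : ℂ) ≠ 0 := by exact_mod_cast Nat.factorial_ne_zero _
    have hj' : 2 * (j : ℂ) + 1 ≠ 0 := by exact_mod_cast Nat.succ_ne_zero (2 * j)
    push_cast
    have h4 : (4 : ℂ) ^ (2 * j + 1) = 2 ^ (2 * j + 1) * (2 ^ (2 * j + 1)) := by
      rw [← mul_pow]; norm_num
    have h5 : (4 : ℂ) ^ (j + 1) = 2 * 2 ^ (2 * j + 1) := by
      rw [show (4 : ℂ) = 2 ^ 2 by norm_num, ← pow_mul]; ring
    rw [h4, h5, mul_pow (2 : ℂ), pow_succ (-1 : ℂ)]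
    field_simp
  · rcases eq_or_ne n 0 with rfl | hn
    · simp
    · rw [LSeries.term_of_ne_zero hn, Complex.cpow_natCast, sin_two_pi_mul_quarter,
        chiNegFour_natCast]
      push_cast
      ring

/-- The functional equation of the secant Dirichlet series on the upper half-plane. -/
lemma secantSeries_functional_of_pos {m : ℕ} (hm : 0 < m) {τ : ℂ} (hτ : 0 < τ.im) :
    (2 * τ + 1) ^ (2 * m - 1) * secantSeries (2 * m) (τ / (2 * τ + 1)) - secantSeries (2 * m) τ =
      ((Real.pi : ℂ) * I) ^ (2 * m) * ∑ n ∈ Finset.range (m + 1),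
        (2 : ℂ) ^ (2 * (n : ℤ) - 1) * ((bernoulli (2 * n) : ℚ) : ℂ) *
          ((eulerNum (2 * m - 2 * n) : ℚ) : ℂ) /
          (((2 * n).factorial : ℂ) * ((2 * m - 2 * n).factorial : ℂ)) *
          τ ^ (2 * m - 2 * n) * (1 - (2 * τ + 1) ^ (2 * (n : ℤ) - 1)) := by
  have hone : (1 : DirichletCharacter ℂ 1) (-1) = 1 := MulChar.one_apply isUnit_one.neg
  have hpar : (1 : DirichletCharacter ℂ 1) (-1) * chiNegFour (-1) = (-1) ^ (2 * m + 1) := by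
    rw [chiNegFour_neg_one, hone]
    simp [pow_succ, pow_mul]
  have hk : 3 ≤ 2 * m + 1 := by omega
  have hd : 2 * τ + 1 ≠ 0 := fun h ↦ by
    have := congrArg Complex.im h
    simp at this
    exact hτ.ne' this
  have hsec : ∀ z : ℂ, 0 < z.im → secantSeries (2 * m) z =
      1 / Real.pi * cotSeries (2 * m + 1) (1 : DirichletCharacter ℂ 1) chiNegFour (2 * z) := by
    intro z hz
    have h := (hasSum_secantTerm hm ⟨2 * z, by simpa using hz⟩).tsum_eq
    rw [eichlerEisenstein_eq_cotSeries hk _ chiNegFour_ne_one hpar, UpperHalfPlane.coe_mk,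
      mul_div_cancel_left₀ z two_ne_zero] at h
    rw [secantSeries, h]
    have hm' : (m : ℂ) ≠ 0 := by exact_mod_cast hm.ne'
    push_cast
    field_simp
    ring
  have hτ' : 0 < (τ / (2 * τ + 1)).im := by
    have : τ / (2 * τ + 1) = (τ⁻¹ + 2)⁻¹ := by
      have : τ ≠ 0 := by rintro rfl; simp at hτ
      rw [← inv_inj, inv_inv, inv_div]
      field_simp
      ring
    rw [this, inv_im, add_im, inv_im]
    have h1 : 0 < normSq τ := normSq_pos.mpr (by rintro rfl; simp at hτ)
    have h2 : τ⁻¹ + 2 ≠ 0 := fun h ↦ by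
      have := congrArg Complex.im h
      rw [add_im, inv_im] at this
      simp only [im_ofNat, add_zero, zero_im, div_eq_zero_iff, neg_eq_zero] at this
      rcases this with h | h <;> linarith
    simp only [im_ofNat, add_zero, neg_div, neg_neg]
    exact div_pos (div_pos hτ h1) (normSq_pos.mpr h2)
  have hfe := cotSeries_sub_slash hk (DirichletCharacter.isPrimitive_one_level_one (R := ℂ))
    isPrimitive_chiNegFour hpar chiNegFour_ne_one (τ := 2 * τ) (by simpa using hτ.ne')
    (n := 1) (by simp)
  rw [hsec τ hτ, hsec _ hτ', mul_div_assoc']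
  rw [Int.cast_one, one_mul, show 2 * m + 1 - 2 = 2 * m - 1 by omega] at hfe
  have hlhs : (2 * τ + 1) ^ (2 * m - 1) * (1 / Real.pi *
      cotSeries (2 * m + 1) (1 : DirichletCharacter ℂ 1) chiNegFour (2 * τ / (2 * τ + 1))) -
      1 / Real.pi * cotSeries (2 * m + 1) (1 : DirichletCharacter ℂ 1) chiNegFour (2 * τ) =
      -(1 / Real.pi) * (cotSeries (2 * m + 1) (1 : DirichletCharacter ℂ 1) chiNegFour (2 * τ) -
      (2 * τ + 1) ^ (2 * m - 1) *
      cotSeries (2 * m + 1) (1 : DirichletCharacter ℂ 1) chiNegFour (2 * τ / (2 * τ + 1))) := by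
    ring
  rw [hlhs, hfe, chiNegFour_neg_one, hone, ← mul_assoc, Finset.mul_sum, Finset.mul_sum]
  -- As `χ(-1) = 1`, the sum runs over the even `s = 2 n`.
  refine Finset.sum_nbij' (fun s ↦ s / 2) (fun n ↦ 2 * n) ?_ ?_ ?_ ?_ ?_
  · intro s
    simp only [Finset.mem_filter, Finset.mem_range]
    omega
  · intro n
    simp only [Finset.mem_filter, Finset.mem_range, pow_mul, neg_one_sq, one_pow, and_true]
    omega
  · intro s hs
    have h := (Finset.mem_filter.mp hs).2
    have : Even s := by
      by_contra h1
      rw [(Nat.not_even_iff_odd.mp h1).neg_one_pow] at h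
      norm_num at h
    exact Nat.two_mul_div_two_of_even this
  · intro n _
    simp
  · intro s hs
    have h := (Finset.mem_filter.mp hs).2
    have hev : Even s := by
      by_contra h1
      rw [(Nat.not_even_iff_odd.mp h1).neg_one_pow] at h
      norm_num at h
    have hsr := Finset.mem_range.mp (Finset.mem_filter.mp hs).1
    obtain ⟨n, rfl⟩ := hev.two_dvd
    obtain ⟨j, rfl⟩ : ∃ j, m = n + j := Nat.exists_eq_add_of_le (by omega)
    rw [Nat.mul_div_cancel_left _ two_pos, DirichletCharacter.LFunction_modOne_eq,
      show (((2 * (n + j) + 1 : ℕ) : ℂ) - ((2 * n : ℕ) : ℂ)) = ((2 * j + 1 : ℕ) : ℂ) by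
        push_cast; ring, LFunction_chiNegFour,
      show ((2 * (n + j) + 1 : ℕ) : ℤ) - ((2 * n : ℕ) : ℤ) - 1 = (2 * j : ℕ) by push_cast; ring,
      zpow_natCast, show 2 * (n + j) - 2 * n = 2 * j by omega,
      show ((2 * n : ℕ) : ℂ) = 2 * (n : ℂ) by push_cast; ring, riemannZeta_two_mul_nat',
      mul_pow (Real.pi : ℂ) I, pow_mul I, I_sq]
    have hpi : (Real.pi : ℂ) ≠ 0 := ofReal_ne_zero.mpr Real.pi_ne_zero
    have hf : ((2 * j).factorial : ℂ) ≠ 0 := by exact_mod_cast Nat.factorial_ne_zero _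
    have hf' : ((2 * n).factorial : ℂ) ≠ 0 := by exact_mod_cast Nat.factorial_ne_zero _
    have h4 : (4 : ℂ) ^ (j + 1) = 4 * 2 ^ (2 * j) := by
      rw [show (4 : ℂ) = 2 ^ 2 by norm_num, ← pow_mul]; ring
    rw [h4, mul_pow (2 : ℂ) τ]
    push_cast
    field_simp
    ring

/-- The functional equation of the secant Dirichlet series; the lower half-plane is reached by
complex conjugation. -/
lemma secantSeries_functional {m : ℕ} (hm : 0 < m) {τ : ℂ} (hτ : τ.im ≠ 0) :
    (2 * τ + 1) ^ (2 * m - 1) * secantSeries (2 * m) (τ / (2 * τ + 1)) - secantSeries (2 * m) τ =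
      ((Real.pi : ℂ) * I) ^ (2 * m) * ∑ n ∈ Finset.range (m + 1),
        (2 : ℂ) ^ (2 * (n : ℤ) - 1) * ((bernoulli (2 * n) : ℚ) : ℂ) *
          ((eulerNum (2 * m - 2 * n) : ℚ) : ℂ) /
          (((2 * n).factorial : ℂ) * ((2 * m - 2 * n).factorial : ℂ)) *
          τ ^ (2 * m - 2 * n) * (1 - (2 * τ + 1) ^ (2 * (n : ℤ) - 1)) := by
  rcases lt_or_gt_of_ne hτ with h | h
  · have h1 := congrArg (starRingEnd ℂ) (secantSeries_functional_of_pos hm (τ := starRingEnd ℂ τ)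
      (by simpa using h))
    have h2 : starRingEnd ℂ τ / (2 * starRingEnd ℂ τ + 1) = starRingEnd ℂ (τ / (2 * τ + 1)) := by
      rw [map_div₀, map_add, map_mul, map_ofNat, map_one]
    rw [h2, secantSeries_conj, secantSeries_conj] at h1
    simp only [map_sub, map_mul, map_pow, map_add, map_sum, map_div₀, map_zpow₀, map_one,
      Complex.conj_conj, map_ofNat, map_natCast, map_ratCast, conj_ofReal, conj_I] at h1
    rw [h1, mul_neg, (even_two_mul m).neg_pow]
  · exact secantSeries_functional_of_pos hm h

end

theorem corollary2 :
    (∀ (k L M : ℕ) [NeZero L] [NeZero M]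
        (χ : DirichletCharacter ℂ L) (ψ : DirichletCharacter ℂ M),
      3 ≤ k → χ.IsPrimitive → ψ.IsPrimitive → χ (-1) * ψ (-1) = (-1) ^ k → ψ ≠ 1 →
        -- the objects are well defined: the Eisenstein series converges absolutely on the upper
        -- half-plane, it has a limit at `i∞`, and its Eichler integral converges absolutely
        ((∀ τ : ℍ, Summable (eisensteinTerm k χ ψ τ)) ∧
          (∃ a₀ : ℂ, Filter.Tendsto (eisensteinChar k χ ψ) atImInfty (nhds a₀)) ∧
          (∀ τ : ℍ, MeasureTheory.IntegrableOn
            (eichlerIntegrand k (eisensteinChar k χ ψ) τ) (Set.Ioi 0))) ∧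
        -- the functional equation
        ∀ n : ℤ, (L : ℤ) ∣ n → ∀ τ : ℍ,
          (eichlerEisenstein k χ ψ - eichlerEisenstein k χ ψ ∣[(2 : ℤ) - (k : ℤ)] (matR ^ n)) τ =
            -(4 * ψ (-1) / ((k : ℂ) - 1)) *
              ∑ s ∈ Finset.range (k + 1) with χ (-1) = (-1) ^ s,
                χ.LFunction (s : ℂ) * ψ.LFunction ((k : ℂ) - (s : ℂ)) *
                  (τ : ℂ) ^ ((k : ℤ) - (s : ℤ) - 1) *
                  (1 - ((n : ℂ) * (τ : ℂ) + 1) ^ ((s : ℤ) - 1))) ∧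
    -- the case `χ = 1`, `ψ = χ₋₄`, `k = 2 m + 1`
    (∀ m : ℕ, 0 < m →
      (∀ τ : ℂ, τ.im ≠ 0 → Summable (secantTerm (2 * m) τ)) ∧
      (∀ τ : ℍ, secantSeries (2 * m) ((τ : ℂ) / 2) =
        2 * (m : ℂ) / (Real.pi : ℂ) *
          eichlerEisenstein (2 * m + 1) (1 : DirichletCharacter ℂ 1) chiNegFour τ) ∧
      ∀ τ : ℂ, τ.im ≠ 0 →
        (2 * τ + 1) ^ (2 * m - 1) * secantSeries (2 * m) (τ / (2 * τ + 1)) -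
            secantSeries (2 * m) τ =
          ((Real.pi : ℂ) * I) ^ (2 * m) *
            ∑ n ∈ Finset.range (m + 1),
              (2 : ℂ) ^ (2 * (n : ℤ) - 1) *
                ((bernoulli (2 * n) : ℚ) : ℂ) * ((eulerNum (2 * m - 2 * n) : ℚ) : ℂ) /
                (((2 * n).factorial : ℂ) * ((2 * m - 2 * n).factorial : ℂ)) *
                τ ^ (2 * m - 2 * n) * (1 - (2 * τ + 1) ^ (2 * (n : ℤ) - 1))) := by
  refine ⟨fun k L M _ _ χ ψ hk hχ hψ hpar hψ1 ↦ ⟨⟨summable_eisensteinTerm hk χ ψ,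
    ⟨_, tendsto_eisensteinChar hk χ ψ hpar⟩, fun τ ↦ (eichler_fourier hk χ ψ hpar τ).1⟩,
    fun n hn τ ↦ eichlerEisenstein_sub_slash hk hχ hψ hpar hψ1 hn τ⟩, fun m hm ↦
    ⟨fun τ hτ ↦ summable_secantTerm hm hτ, fun τ ↦ (hasSum_secantTerm hm τ).tsum_eq,
    fun τ hτ ↦ secantSeries_functional hm hτ⟩⟩
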